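/- Let $Q=\begin{pmatrix} q_1 & q\\ \bar q & q_2\end{pmatrix}:\mathbb R\to M_2(\mathbb C)$ be Hermitian, $\pi$-periodic and integrable on $[0,\pi)$, so that $q_1,q_2$ are real valued and $q$ is complex valued. Put $$J=\begin{pmatrix}0&1\\-1&0\end{pmatrix},\quad \sigma_1=\begin{pmatrix}0&1\\1&0\end{pmatrix},\quad \sigma_2=\begin{pmatrix}0&i\\-i&0\end{pmatrix},\quad \sigma_3=\begin{pmatrix}1&0\\0&-1\end{pmatrix},$$ let $\mathbb I$ be the identity matrix, and write $Q=Q_1+Q_2$ with $$Q_1=\operatorname{Re}(q)\,\sigma_1+\tfrac12(q_1-q_2)\,\sigma_3,\qquad Q_2=\tfrac12(q_1+q_2)\,\mathbb I+\operatorname{Im}(q)\,\sigma_2 .$$ For $\lambda\in\mathbb C$ let $\mathbb Y(\lambda,\cdot)$ be the fundamental matrix of $JY'+QY=\lambda Y$ on $\mathbb R$ with $\mathbb Y(\lambda,0)=\mathbb I$ (locally absolutely continuous entries, equation satisfied almost everywhere), and let $\Delta(\lambda)=\operatorname{tr}\mathbb Y(\lambda,\pi)$ be the discriminant. Further let $$R(z)=\exp\Bigl(J\int_0^z\Bigl(Q_2(t)-\tfrac1\pi\int_0^\pi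 Q_2\,d\tau\Bigr)dt\Bigr),\qquad \tilde Q_1(z)=R(z)^{-1}Q_1(z)R(z),\qquad \tilde Q_2(z)=\tfrac1\pi\int_0^\pi Q_2\,dt .$$ An entire function is said to have only double zeros if each of its zeros in $\mathbb C$ has order exactly $2$. Then the following hold. (a) If $Q_1(x+\frac\pi2)=-Q_1(x)$ and $Q_2(x+\frac\pi2)=Q_2(x)$ for almost every $x\in\mathbb R$, then the function $\lambda\mapsto\Delta(\lambda)-2e^{-i\int_0^\pi\operatorname{Im}q\,dt}$ has only double zeros. (b) Conversely, if $\lambda\mapsto\Delta(\lambda)-2e^{-i\int_0^\pi\operatorname{Im}q\,dt}$ has only double zeros, then $\tilde Q_1(x+\frac\pi2)=-\tilde Q_1(x)$ and $\tilde Q_2(x+\frac\pi2)=\tilde Q_2(x)$ for almost every $x\in\mathbb R$. -/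

import Mathlib

open MeasureTheory

namespace SelfAdjointSystem

noncomputable section

/-- The `2 × 2` complex matrices. -/
abbrev M2 : Type := Matrix (Fin 2) (Fin 2) ℂ

/-- The symplectic matrix `J`. -/
def J : M2 := !![0, 1; -1, 0]

/-- The Pauli matrix `σ₁`. -/
def pauli1 : M2 := !![0, 1; 1, 0]

/-- The Pauli matrix `σ₂ = i J` (in this sign convention). -/
def pauli2 : M2 := !![0, Complex.I; -Complex.I, 0]

/-- The Pauli matrix `σ₃`. -/
def pauli3 : M2 := !![1, 0; 0, -1]

/-- Entrywise integral `∫₀ᶻ F(t) dt` of a matrix valued function. -/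
def matIntegral (F : ℝ → M2) (z : ℝ) : M2 :=
  Matrix.of fun i j => ∫ t in (0 : ℝ)..z, F t i j

/-- The component `Q₁ = Re(q) σ₁ + ½ (q₁ - q₂) σ₃` of `Q = (q₁, q; q*, q₂)`, which anticommutes
with `J`. -/
def Q1 (Q : ℝ → M2) (x : ℝ) : M2 :=
  ((Q x 0 1).re : ℂ) • pauli1 + ((Q x 0 0 - Q x 1 1) / 2) • pauli3

/-- The component `Q₂ = ½ (q₁ + q₂) σ₀ + Im(q) σ₂` of `Q = (q₁, q; q*, q₂)`, which commutes
with `J`. -/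
def Q2 (Q : ℝ → M2) (x : ℝ) : M2 :=
  ((Q x 0 0 + Q x 1 1) / 2) • (1 : M2) + ((Q x 0 1).im : ℂ) • pauli2

/-- `Y` is the fundamental matrix of `J Y' + Q Y = lam Y` on `ℝ`, normalised at `0`: its entries are
absolutely continuous on every compact interval, the equation holds almost everywhere, and `Y(0)`
is the identity matrix. -/
structure IsFundamentalMatrix (Q : ℝ → M2) (lam : ℂ) (Y : ℝ → M2) : Prop where
  absolutelyContinuous : ∀ (i j : Fin 2) (a b : ℝ),
    AbsolutelyContinuousOnInterval (fun x => Y x i j) a b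
  equation : ∀ᵐ x : ℝ, ∃ Y' : M2,
    (∀ i j : Fin 2, HasDerivAt (fun t => Y t i j) (Y' i j) x) ∧ J * Y' + Q x * Y x = lam • Y x
  initial : Y 0 = 1

/-- The fundamental matrix `𝕐(lam, ·)` of `J Y' + Q Y = lam Y` with `𝕐(lam, 0) = 𝕀`. For `Q`
integrable on compact intervals there is exactly one function with the defining property, so this
choice selects it. -/
def fundamentalMatrix (Q : ℝ → M2) (lam : ℂ) : ℝ → M2 :=
  Classical.epsilon (IsFundamentalMatrix Q lam)

/-- The discriminant `Δ(lam) = y₁₁(π) + y₂₂(π)`, the trace of the monodromy matrix. -/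
def discriminant (Q : ℝ → M2) (lam : ℂ) : ℂ :=
  (fundamentalMatrix Q lam Real.pi).trace

/-- The mean value `(1/π) ∫₀^π Q₂ dt`. -/
def meanQ2 (Q : ℝ → M2) : M2 :=
  (Real.pi : ℂ)⁻¹ • matIntegral (Q2 Q) Real.pi

/-- The gauge transformation `R(z) = exp (J ∫₀ᶻ (Q₂ - (1/π) ∫₀^π Q₂ dτ) dt)`. -/
def R (Q : ℝ → M2) (z : ℝ) : M2 :=
  NormedSpace.exp (J * matIntegral (fun t => Q2 Q t - meanQ2 Q) z)

/-- `Q̃₁(z) = R(z)⁻¹ Q₁(z) R(z)`. -/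
def Q1tilde (Q : ℝ → M2) (z : ℝ) : M2 := (R Q z)⁻¹ * Q1 Q z * R Q z

/-- `Q̃₂(z) = (1/π) ∫₀^π Q₂ dt`, a constant function of `z`. -/
def Q2tilde (Q : ℝ → M2) (_z : ℝ) : M2 := meanQ2 Q

/-- Every complex zero of `f` is a zero of order exactly two. -/
def OnlyDoubleZeros (f : ℂ → ℂ) : Prop :=
  ∀ lam : ℂ, f lam = 0 → analyticOrderAt f lam = 2

end

end SelfAdjointSystem

open MeasureTheory Set Filter Topology intervalIntegral Matrix

/-! The part of `Q` commuting with `J` is removed by a gauge. A scalar phase absorbs `Im q`, and a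
rotation by `θ = angle Q` absorbs the oscillating part of `(q₁ + q₂)/2`. What remains is a Dirac
system `Y' = J (V - μ) Y` with `V = Q1tilde Q` real, symmetric and trace free, and `μ` is `lam`
minus the mean of `(q₁ + q₂)/2`. Since `θ(π) = 0`, the discriminant is `exp(-i ∫ Im q)` times that
of `V` at `μ`, so both claims concern the zeros of `disc - 2` for `V`. Write `M(x)` for the
fundamental matrix of `V`.

(a) If `Q₂` has period `π/2`, so has `θ`, and `V` is antiperiodic over `π/2`. As `J V = -V J`, this
gives `M(π) = -J M J M` with `M = M(π/2)`, and `det M = 1` yields `disc - 2 = -(m₁₂ - m₂₁)²`. The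
Lagrange identity makes the zeros real. It also expresses `∂M/∂lam` by the positive Gram matrix of
the solutions, so the zeros of `m₁₂ - m₂₁` are simple (`disc_sub_two_eq`,
`skew_hasDerivAt_re_ne_zero`).

(b) At a double zero, positivity of the Gram matrix forces `M(π) = 1`, so the transfer matrices `M`
and `N` over the two half periods satisfy `N⁻¹ = M`. The difference `C = N⁻¹ - M` is asymptotically
`2 sin(lam π/2) J`; hence `c₁₁`, `c₂₂` and `c₁₂ + c₂₁` are `o(exp(|Im lam| π/2))` and vanish
wherever `disc = 2`. For each such `n`, the quotient `n² / (disc - 2)` is entire because the zeros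
are double, and it tends to zero on the circles of odd radius, so `n = 0`
(`eq_zero_of_onlyDoubleZeros`). Thus `C` is a multiple of `J`.

Translating `V` by `x` does not change `disc`, so the same holds for every translate: `M(x + π/2) K
M(x)⁻¹ = h(x) J` with `K = M(π)⁻¹ - 1`. Determinants give `h² = 2 - disc`, so `h` is constant in
`x`. Differentiating `M(x + π/2) K = h J M(x)` at one `lam` with `disc ≠ 2` gives `V(x + π/2) =
-V(x)`. -/

namespace SelfAdjointSystem

/-! ### Calculus of locally absolutely continuous antiderivatives -/

section Antiderivative

variable {E : Type*} [NormedAddCommGroup E] [NormedSpace ℝ E]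

/-- `F` is a (locally absolutely continuous) antiderivative of the locally integrable `f`. -/
structure IsIntegralOf (F f : ℝ → E) : Prop where
  intervalIntegrable : ∀ a b : ℝ, IntervalIntegrable f volume a b
  eq_add : ∀ x, F x = F 0 + ∫ t in (0 : ℝ)..x, f t

/-- A dominated function inherits absolute continuity. -/
theorem absolutelyContinuousOnInterval_of_dist_le {X Y : Type*} [PseudoMetricSpace X]
    [PseudoMetricSpace Y] {F : ℝ → X} {G : ℝ → Y} {a b : ℝ}
    (hG : AbsolutelyContinuousOnInterval G a b) (h : ∀ x y, dist (F x) (F y) ≤ dist (G x) (G y)) :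
    AbsolutelyContinuousOnInterval F a b :=
  squeeze_zero (fun _ => Finset.sum_nonneg fun _ _ => dist_nonneg)
    (fun _ => Finset.sum_le_sum fun _ _ => h _ _) hG

namespace IsIntegralOf

variable {F G f g : ℝ → E}

theorem sub_eq (h : IsIntegralOf F f) (a b : ℝ) : F b - F a = ∫ t in a..b, f t := by
  rw [h.eq_add b, h.eq_add a, add_sub_add_left_eq_sub,
    integral_interval_sub_left (h.intervalIntegrable _ _) (h.intervalIntegrable _ _)]

theorem of_intervalIntegrable (hf : ∀ a b : ℝ, IntervalIntegrable f volume a b) (c : E) :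
    IsIntegralOf (fun x => c + ∫ t in (0 : ℝ)..x, f t) f :=
  ⟨hf, fun x => by simp⟩

theorem absolutelyContinuousOnInterval (h : IsIntegralOf F f) (a b : ℝ) :
    AbsolutelyContinuousOnInterval F a b := by
  have hn : ∀ a b : ℝ, IntervalIntegrable (fun t => ‖f t‖) volume a b :=
    fun a b => (h.intervalIntegrable a b).norm
  refine absolutelyContinuousOnInterval_of_dist_le
    ((hn a b).absolutelyContinuousOnInterval_intervalIntegral (c := a) left_mem_uIcc)
    fun x y => ?_
  rw [dist_comm, dist_eq_norm, h.sub_eq, dist_comm, Real.dist_eq,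
    integral_interval_sub_left (hn _ _) (hn _ _)]
  exact norm_integral_le_abs_integral_norm

theorem continuous (h : IsIntegralOf F f) : Continuous F := by
  have : F = fun x => F 0 + ∫ t in (0 : ℝ)..x, f t := funext h.eq_add
  rw [this]
  exact continuous_const.add (continuous_primitive h.intervalIntegrable 0)

theorem ae_hasDerivAt [CompleteSpace E] (h : IsIntegralOf F f) :
    ∀ᵐ x, HasDerivAt F (f x) x := by
  have hl : LocallyIntegrable f volume := by
    intro x
    refine ⟨Icc (x - 1) (x + 1), Icc_mem_nhds (by linarith) (by linarith), ?_⟩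
    exact (intervalIntegrable_iff_integrableOn_Icc_of_le (by linarith)).1
      (h.intervalIntegrable (x - 1) (x + 1))
  filter_upwards [LocallyIntegrable.ae_hasDerivAt_integral hl] with x hx
  have := (hx 0).const_add (F 0)
  rwa [← funext h.eq_add] at this

/-- The difference from the indefinite integral is absolutely continuous with derivative zero almost
everywhere, hence constant. -/
theorem of_absolutelyContinuous [CompleteSpace E]
    (hac : ∀ a b : ℝ, AbsolutelyContinuousOnInterval F a b)
    (hd : ∀ᵐ x, HasDerivAt F (f x) x) (hi : ∀ a b : ℝ, IntervalIntegrable f volume a b) :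
    IsIntegralOf F f := by
  refine ⟨hi, fun x => ?_⟩
  have hI := of_intervalIntegrable hi (F 0)
  obtain ⟨C, hC⟩ := ((hac 0 x).sub (hI.absolutelyContinuousOnInterval 0 x)).const_of_ae_hasDerivAt_zero
    (by
      filter_upwards [hd, hI.ae_hasDerivAt] with y h1 h2 _
      simpa using h1.sub h2)
  have h0 := hC 0 left_mem_uIcc
  have hx := hC x right_mem_uIcc
  simp only [Pi.sub_apply, integral_same, add_zero, sub_self] at h0 hx
  rw [← h0] at hx
  exact sub_eq_zero.1 hx

theorem congr_ae (h : IsIntegralOf F f) (hfg : ∀ᵐ x, f x = g x) : IsIntegralOf F g := by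
  refine ⟨fun a b => (h.intervalIntegrable a b).congr_ae (ae_restrict_of_ae hfg), fun x => ?_⟩
  rw [h.eq_add x, intervalIntegral.integral_congr_ae (g := g)]
  filter_upwards [hfg] with x hx _ using hx

theorem of_hasDerivAt [CompleteSpace E] (hd : ∀ x, HasDerivAt F (f x) x) (hf : Continuous f) :
    IsIntegralOf F f := by
  refine ⟨fun a b => hf.intervalIntegrable a b, fun x => ?_⟩
  rw [integral_eq_sub_of_hasDerivAt (fun x _ => hd x) (hf.intervalIntegrable 0 x)]
  abel

theorem add (hF : IsIntegralOf F f) (hG : IsIntegralOf G g) :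
    IsIntegralOf (fun x => F x + G x) (fun x => f x + g x) := by
  refine ⟨fun a b => (hF.intervalIntegrable a b).add (hG.intervalIntegrable a b), fun x => ?_⟩
  rw [integral_add (hF.intervalIntegrable 0 x) (hG.intervalIntegrable 0 x), hF.eq_add x,
    hG.eq_add x]
  abel

theorem sub (hF : IsIntegralOf F f) (hG : IsIntegralOf G g) :
    IsIntegralOf (fun x => F x - G x) (fun x => f x - g x) := by
  refine ⟨fun a b => (hF.intervalIntegrable a b).sub (hG.intervalIntegrable a b), fun x => ?_⟩
  rw [integral_sub (hF.intervalIntegrable 0 x) (hG.intervalIntegrable 0 x), hF.eq_add x,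
    hG.eq_add x]
  abel

theorem const (c : E) : IsIntegralOf (fun _ => c) (fun _ => (0 : E)) :=
  ⟨fun _ _ => intervalIntegrable_const, fun x => by simp⟩

theorem comp_add_right (h : IsIntegralOf F f) (c : ℝ) :
    IsIntegralOf (fun x => F (x + c)) (fun x => f (x + c)) := by
  refine ⟨fun a b => by simpa using (h.intervalIntegrable (a + c) (b + c)).comp_add_right c,
    fun x => ?_⟩
  have := h.sub_eq (0 + c) (x + c)
  rw [integral_comp_add_right (fun t => f t) c, ← this]
  abel

theorem clm_comp {E' : Type*} [NormedAddCommGroup E'] [NormedSpace ℝ E'] [CompleteSpace E]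
    [CompleteSpace E'] (L : E →L[ℝ] E') (h : IsIntegralOf F f) :
    IsIntegralOf (fun x => L (F x)) (fun x => L (f x)) := by
  refine ⟨fun a b => ⟨L.integrable_comp (h.intervalIntegrable a b).1,
    L.integrable_comp (h.intervalIntegrable a b).2⟩, fun x => ?_⟩
  rw [L.intervalIntegral_comp_comm (h.intervalIntegrable 0 x), ← map_add, ← h.eq_add x]

end IsIntegralOf

/-- Both factors are bounded on compact intervals, so increments of the product are dominated by
those of the factors; the product rule almost everywhere then suffices. No commutativity is needed,
which allows matrix products. -/
theorem IsIntegralOf.mul {𝔸 : Type*} [NormedRing 𝔸] [NormedAlgebra ℝ 𝔸] [CompleteSpace 𝔸]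
    {F G f g : ℝ → 𝔸} (hF : IsIntegralOf F f) (hG : IsIntegralOf G g) :
    IsIntegralOf (fun x => F x * G x) (fun x => f x * G x + F x * g x) := by
  refine .of_absolutelyContinuous (fun a b => ?_) ?_ fun a b => ?_
  · obtain ⟨C, hC⟩ := (hF.absolutelyContinuousOnInterval a b).exists_bound
    obtain ⟨D, hD⟩ := (hG.absolutelyContinuousOnInterval a b).exists_bound
    have tF : Tendsto _ _ _ := hF.absolutelyContinuousOnInterval a b
    have tG : Tendsto _ _ _ := hG.absolutelyContinuousOnInterval a b
    have tS := (tG.const_mul C).add (tF.const_mul D)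
    simp only [mul_zero, add_zero] at tS
    refine squeeze_zero' (Eventually.of_forall fun _ => Finset.sum_nonneg fun _ _ => dist_nonneg)
      ?_ tS
    rw [eventually_inf_principal]
    filter_upwards with ⟨n, I⟩ hnI
    simp only [Finset.mul_sum, ← Finset.sum_add_distrib]
    refine Finset.sum_le_sum fun i hi => ?_
    have h1 := hC _ (hnI.1 i hi).1
    have h2 := hD _ (hnI.1 i hi).2
    rw [dist_eq_norm, dist_eq_norm, dist_eq_norm]
    have e : F (I i).1 * G (I i).1 - F (I i).2 * G (I i).2
        = F (I i).1 * (G (I i).1 - G (I i).2) + (F (I i).1 - F (I i).2) * G (I i).2 := by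
      noncomm_ring
    rw [e, mul_comm D]
    refine (norm_add_le _ _).trans (add_le_add ((norm_mul_le _ _).trans ?_)
      ((norm_mul_le _ _).trans ?_)) <;> gcongr
  · filter_upwards [hF.ae_hasDerivAt, hG.ae_hasDerivAt] with x h1 h2 using h1.mul h2
  · exact ((hF.intervalIntegrable a b).mul_continuousOn hG.continuous.continuousOn).add
      ((hG.intervalIntegrable a b).continuousOn_mul hF.continuous.continuousOn)

/-- The powers of a primitive, normalised by factorials. -/
theorem IsIntegralOf.pow_div_factorial {α a : ℝ → ℝ} (h : IsIntegralOf α a) (n : ℕ) :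
    IsIntegralOf (fun x => α x ^ (n + 1) / (n + 1).factorial)
      (fun x => a x * (α x ^ n / n.factorial)) := by
  induction n with
  | zero => simpa using h
  | succ n ih =>
    have := ih.mul h
    have h2 := this.clm_comp ((n + 2 : ℝ)⁻¹ • ContinuousLinearMap.id ℝ ℝ)
    have hn : (n : ℝ) + 2 ≠ 0 := by positivity
    have hn' : (n : ℝ) + 1 ≠ 0 := by positivity
    have hf : (n.factorial : ℝ) ≠ 0 := by positivity
    convert h2 using 2
    · simp [Nat.factorial_succ]
      field_simp
      ring
    · simp [Nat.factorial_succ]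
      field_simp
      ring

end Antiderivative

end SelfAdjointSystem

namespace SelfAdjointSystem

/-! ### Linear differential equations with integrable coefficients -/

section LinearODE

theorem isIntegralOf_integral {a : ℝ → ℝ} (ha : ∀ s t : ℝ, IntervalIntegrable a volume s t) :
    IsIntegralOf (fun x => ∫ t in (0 : ℝ)..x, a t) a := by
  simpa using IsIntegralOf.of_intervalIntegrable ha 0

/-- Gronwall's inequality with an integrable coefficient. -/
theorem le_mul_exp_of_le_add_integral {a w : ℝ → ℝ} {ε l : ℝ}
    (ha : ∀ s t : ℝ, IntervalIntegrable a volume s t) (ha0 : ∀ t, 0 ≤ a t) (hw : Continuous w)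
    (hε : 0 ≤ ε) (h : ∀ x ∈ Icc 0 l, w x ≤ ε + ∫ t in (0 : ℝ)..x, a t * w t) :
    ∀ x ∈ Icc 0 l, w x ≤ ε * Real.exp (∫ t in (0 : ℝ)..x, a t) := by
  set α : ℝ → ℝ := fun x => ∫ t in (0 : ℝ)..x, a t with hα
  have hI : IsIntegralOf α a := isIntegralOf_integral ha
  have hα0 : α 0 = 0 := by simp [hα]
  have hαn : ∀ x ∈ Icc 0 l, 0 ≤ α x := fun x hx => integral_nonneg hx.1 fun t _ => ha0 t
  obtain ⟨M, hM⟩ := (isCompact_Icc (a := (0 : ℝ)) (b := l)).exists_bound_of_continuousOn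
    hw.continuousOn
  -- Inserting the inequality into itself `n` times builds the partial sums of the exponential; the
  -- crude bound `M` enters only with a factor `α ^ n / n!`, which tends to zero.
  have key : ∀ n : ℕ, ∀ x ∈ Icc 0 l,
      w x ≤ ε * ∑ k ∈ Finset.range n, α x ^ k / k.factorial + M * (α x ^ n / n.factorial) := by
    intro n
    induction n with
    | zero =>
      intro x hx
      simpa using (le_abs_self _).trans (hM x hx)
    | succ n ih =>
      intro x hx
      refine (h x hx).trans ?_
      have hint : ∀ k : ℕ, IntervalIntegrable (fun t => a t * (α t ^ k / k.factorial)) volume 0 x :=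
        fun k => (hI.pow_div_factorial k).intervalIntegrable 0 x
      have hval : ∀ k : ℕ, ∫ t in (0 : ℝ)..x, a t * (α t ^ k / k.factorial)
          = α x ^ (k + 1) / (k + 1).factorial := fun k => by
        rw [← (hI.pow_div_factorial k).sub_eq 0 x]; simp [hα0]
      have e : ∀ t, a t * (ε * ∑ k ∈ Finset.range n, α t ^ k / k.factorial
          + M * (α t ^ n / n.factorial)) = ε * ∑ k ∈ Finset.range n, a t * (α t ^ k / k.factorial)
          + M * (a t * (α t ^ n / n.factorial)) := fun t => by
        rw [Finset.mul_sum, Finset.mul_sum, mul_add, Finset.mul_sum]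
        congr 1
        · exact Finset.sum_congr rfl fun k _ => by ring
        · ring
      have hi1 : IntervalIntegrable
          (fun t => ε * ∑ k ∈ Finset.range n, a t * (α t ^ k / k.factorial)) volume 0 x := by
        refine IntervalIntegrable.const_mul ?_ ε
        rw [show (fun t => ∑ k ∈ Finset.range n, a t * (α t ^ k / k.factorial))
          = ∑ k ∈ Finset.range n, fun t => a t * (α t ^ k / k.factorial) by ext t; simp]
        exact IntervalIntegrable.sum _ fun k _ => hint k
      have hi2 := (hint n).const_mul M
      have hle : ∫ t in (0 : ℝ)..x, a t * w t ≤
          ∫ t in (0 : ℝ)..x, (ε * ∑ k ∈ Finset.range n, a t * (α t ^ k / k.factorial)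
          + M * (a t * (α t ^ n / n.factorial))) := by
        refine integral_mono_on hx.1 ((ha 0 x).mul_continuousOn hw.continuousOn)
          (hi1.add hi2) fun t ht => ?_
        rw [← e]
        exact mul_le_mul_of_nonneg_left (ih t ⟨ht.1, ht.2.trans hx.2⟩) (ha0 t)
      refine (add_le_add_right hle ε).trans (le_of_eq ?_)
      rw [integral_add hi1 hi2, intervalIntegral.integral_const_mul, intervalIntegral.integral_const_mul,
        integral_finsetSum fun k _ => hint k, hval, Finset.sum_range_succ']
      simp only [hval]
      simp
      ring
  intro x hx
  have ht : Tendsto (fun n : ℕ => ε * Real.exp (α x) + M * (α x ^ n / n.factorial)) atTop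
      (𝓝 (ε * Real.exp (α x) + M * 0)) :=
    ((FloorSemiring.tendsto_pow_div_factorial_atTop (α x)).const_mul M).const_add _
  rw [mul_zero, add_zero] at ht
  refine ge_of_tendsto' ht fun n => (key n x hx).trans ?_
  gcongr
  exact Real.sum_le_exp_of_nonneg (hαn x hx) n

variable {𝔸 : Type*} [NormedRing 𝔸] [NormedAlgebra ℝ 𝔸]

/-- The terms of the Peano-Baker series. -/
noncomputable def peanoBaker (A : ℝ → 𝔸) : ℕ → ℝ → 𝔸
  | 0 => fun _ => 1
  | n + 1 => fun x => ∫ t in (0 : ℝ)..x, A t * peanoBaker A n t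

variable {A : ℝ → 𝔸}

theorem continuous_peanoBaker (hA : ∀ s t : ℝ, IntervalIntegrable A volume s t) (n : ℕ) :
    Continuous (peanoBaker A n) := by
  induction n with
  | zero => exact continuous_const
  | succ n ih => exact continuous_primitive (fun s t => (hA s t).mul_continuousOn ih.continuousOn) 0

theorem norm_peanoBaker_le (hA : ∀ s t : ℝ, IntervalIntegrable A volume s t) (n : ℕ) (x : ℝ) :
    ‖peanoBaker A n x‖ ≤ ‖(1 : 𝔸)‖ * (|∫ t in (0 : ℝ)..x, ‖A t‖| ^ n / n.factorial) := by
  set α : ℝ → ℝ := fun x => ∫ t in (0 : ℝ)..x, ‖A t‖ with hα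
  have hI : IsIntegralOf α fun t => ‖A t‖ := isIntegralOf_integral fun s t => (hA s t).norm
  have hα0 : α 0 = 0 := by simp [hα]
  induction n generalizing x with
  | zero => simp [peanoBaker]
  | succ n ih =>
    -- Between `0` and `x` the primitive `α` keeps one sign, so the absolute value becomes a
    -- constant factor `s` that leaves the integral. This treats both sides of the origin at once.
    have hsign : ∃ s : ℝ, |s| = 1 ∧ ∀ t ∈ uIoc 0 x, |α t| ^ n = s * α t ^ n := by
      rcases le_total 0 x with h | h
      · refine ⟨1, by simp, fun t ht => ?_⟩
        rw [uIoc_of_le h] at ht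
        rw [abs_of_nonneg (integral_nonneg ht.1.le fun _ _ => norm_nonneg _), one_mul]
      · refine ⟨(-1) ^ n, by simp, fun t ht => ?_⟩
        rw [uIoc_of_ge h] at ht
        have : α t ≤ 0 := by
          rw [hα]; dsimp only
          rw [integral_symm]
          exact neg_nonpos.2 (integral_nonneg ht.2 fun _ _ => norm_nonneg _)
        rw [abs_of_nonpos this, neg_pow]
    obtain ⟨s, hs, hst⟩ := hsign
    have hg := (hI.pow_div_factorial n).intervalIntegrable 0 x
    have : ‖∫ t in (0 : ℝ)..x, A t * peanoBaker A n t‖ ≤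
        |∫ t in (0 : ℝ)..x, (‖(1 : 𝔸)‖ * s) * (‖A t‖ * (α t ^ n / n.factorial))| := by
      refine norm_integral_le_abs_of_norm_le ?_ (hg.const_mul _)
      rw [ae_restrict_iff' measurableSet_uIoc]
      refine Eventually.of_forall fun t ht => (norm_mul_le _ _).trans ?_
      refine (mul_le_mul_of_nonneg_left (ih t) (norm_nonneg _)).trans (le_of_eq ?_)
      rw [hst t ht]; ring
    refine this.trans (le_of_eq ?_)
    rw [intervalIntegral.integral_const_mul, ← (hI.pow_div_factorial n).sub_eq 0 x, hα0,
      abs_mul, abs_mul, hs, abs_of_nonneg (norm_nonneg _)]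
    simp [abs_div, abs_pow, hα]

theorem IsIntegralOf.norm_le_of_mul {Y : ℝ → 𝔸}
    (hA : ∀ s t : ℝ, IntervalIntegrable A volume s t)
    (hY : IsIntegralOf Y fun t => A t * Y t) {x : ℝ} (hx : 0 ≤ x) :
    ‖Y x‖ ≤ ‖Y 0‖ * Real.exp (∫ t in (0 : ℝ)..x, ‖A t‖) := by
  refine le_mul_exp_of_le_add_integral (l := x) (w := fun x => ‖Y x‖) (fun s t => (hA s t).norm)
    (fun t => norm_nonneg _) hY.continuous.norm (norm_nonneg _) (fun y hy => ?_) x ⟨hx, le_rfl⟩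
  rw [hY.eq_add y]
  refine (norm_add_le _ _).trans (add_le_add_right ?_ _)
  refine intervalIntegral.norm_integral_le_of_norm_le hy.1
    (Eventually.of_forall fun t _ => norm_mul_le _ _)
    ((hA 0 y).norm.mul_continuousOn hY.continuous.norm.continuousOn)

/-- Uniqueness for `Y' = A Y` to the right of the initial point. -/
theorem IsIntegralOf.eq_of_mul {Y Z : ℝ → 𝔸} (hA : ∀ s t : ℝ, IntervalIntegrable A volume s t)
    (hY : IsIntegralOf Y fun t => A t * Y t) (hZ : IsIntegralOf Z fun t => A t * Z t)
    (h0 : Y 0 = Z 0) {x : ℝ} (hx : 0 ≤ x) : Y x = Z x := by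
  have h := (hY.sub hZ)
  have h' : IsIntegralOf (fun x => Y x - Z x) fun t => A t * (Y t - Z t) := by
    simpa only [mul_sub] using h
  have := h'.norm_le_of_mul hA hx
  rw [h0, sub_self, norm_zero, zero_mul] at this
  exact sub_eq_zero.1 (norm_le_zero_iff.1 this)

variable [CompleteSpace 𝔸]

/-- Existence of the fundamental solution of `Y' = A Y` for a locally integrable coefficient. -/
theorem exists_isIntegralOf_mul (hA : ∀ s t : ℝ, IntervalIntegrable A volume s t) :
    ∃ Y : ℝ → 𝔸, Y 0 = 1 ∧ IsIntegralOf Y fun t => A t * Y t := by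
  set α : ℝ → ℝ := fun x => ∫ t in (0 : ℝ)..x, ‖A t‖ with hα
  have hαc : Continuous α := continuous_primitive (fun s t => (hA s t).norm) 0
  have hsumB : ∀ M : ℝ, Summable fun n : ℕ => ‖(1 : 𝔸)‖ * (M ^ n / n.factorial) := fun M =>
    (Real.summable_pow_div_factorial M).mul_left _
  have hbd : ∀ l : ℝ, ∃ M, 0 ≤ M ∧ ∀ x ∈ Icc (-l) l, |α x| ≤ M := fun l => by
    obtain ⟨M, hM⟩ := (isCompact_Icc (a := -l) (b := l)).exists_bound_of_continuousOn
      hαc.continuousOn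
    exact ⟨|M|, abs_nonneg _, fun x hx => (hM x hx).trans (le_abs_self _)⟩
  have hle : ∀ (M : ℝ) (n : ℕ) (x : ℝ), |α x| ≤ M →
      ‖peanoBaker A n x‖ ≤ ‖(1 : 𝔸)‖ * (M ^ n / n.factorial) := fun M n x hx => by
    refine (norm_peanoBaker_le hA n x).trans ?_
    gcongr
  have hsum : ∀ x, Summable fun n => peanoBaker A n x := fun x =>
    Summable.of_norm_bounded (hsumB |α x|) fun n => hle _ n x le_rfl
  set Y : ℝ → 𝔸 := fun x => ∑' n, peanoBaker A n x with hY
  have hYc : Continuous Y := by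
    refine continuous_iff_continuousAt.2 fun x => ?_
    obtain ⟨M, -, hM⟩ := hbd (|x| + 1)
    have hmem : Icc (-(|x| + 1)) (|x| + 1) ∈ 𝓝 x :=
      Icc_mem_nhds (by linarith [neg_abs_le x]) (by linarith [le_abs_self x])
    exact (continuousOn_tsum (fun n => (continuous_peanoBaker hA n).continuousOn) (hsumB M)
      fun n y hy => hle M n y (hM y hy)).continuousAt hmem
  have hint : ∀ s t : ℝ, IntervalIntegrable (fun t => A t * Y t) volume s t := fun s t =>
    (hA s t).mul_continuousOn hYc.continuousOn
  have h0 : ∀ n, peanoBaker A (n + 1) 0 = 0 := fun n => by simp [peanoBaker]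
  -- Splitting off the term `n = 0` and integrating the rest termwise, with the dominating series
  -- `‖A‖ M ^ n / n!`, turns the recursion into the integral equation.
  have hrec : ∀ x, Y x = 1 + ∫ t in (0 : ℝ)..x, A t * Y t := fun x => by
    rw [hY]; dsimp only
    rw [(hsum x).tsum_eq_zero_add]
    congr 1
    obtain ⟨M, hM0, hM⟩ := hbd |x|
    have hmem : ∀ t ∈ uIoc 0 x, |α t| ≤ M := fun t ht => hM t <| by
      have h1 := uIoc_subset_uIcc ht
      rw [mem_uIcc] at h1
      constructor <;> rcases h1 with h1 | h1 <;>
        linarith [neg_abs_le x, le_abs_self x, abs_nonneg x]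
    refine (intervalIntegral.hasSum_integral_of_dominated_convergence
      (F := fun n t => A t * peanoBaker A n t)
      (fun n t => ‖A t‖ * (‖(1 : 𝔸)‖ * (M ^ n / n.factorial))) (fun n => ?_) (fun n => ?_) ?_ ?_
      ?_).tsum_eq
    · exact ((hA 0 x).mul_continuousOn (continuous_peanoBaker hA n).continuousOn).def'.1
    · exact Eventually.of_forall fun t ht => (norm_mul_le _ _).trans
        (mul_le_mul_of_nonneg_left (hle M n t (hmem t ht)) (norm_nonneg _))
    · exact Eventually.of_forall fun t _ => (hsumB M).mul_left _
    · simp only [tsum_mul_left]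
      exact (hA 0 x).norm.mul_const _
    · exact Eventually.of_forall fun t _ => (hsum t).hasSum.mul_left (A t)
  have hY0 : Y 0 = 1 := by rw [hrec 0]; simp
  exact ⟨Y, hY0, hint, fun x => by rw [hY0]; exact hrec x⟩

theorem IsIntegralOf.mul_const {F f : ℝ → 𝔸} (h : IsIntegralOf F f) (c : 𝔸) :
    IsIntegralOf (fun x => F x * c) fun x => f x * c := by
  simpa using h.mul (IsIntegralOf.const c)

theorem IsIntegralOf.const_mul {F f : ℝ → 𝔸} (h : IsIntegralOf F f) (c : 𝔸) :
    IsIntegralOf (fun x => c * F x) fun x => c * f x := by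
  simpa using (IsIntegralOf.const c).mul h

end LinearODE

end SelfAdjointSystem

namespace SelfAdjointSystem

attribute [local instance] Matrix.linftyOpNormedRing Matrix.linftyOpNormedAlgebra

/-- The topology of the operator norm on the `2 × 2` matrices. -/
noncomputable abbrev normTopology : TopologicalSpace M2 :=
  PseudoMetricSpace.toUniformSpace.toTopologicalSpace

/-- The `2 × 2` complex matrices as a real normed algebra. -/
noncomputable abbrev normedAlgebraReal : NormedAlgebra ℝ M2 := Matrix.linftyOpNormedAlgebra

/-- The `2 × 2` complex matrices as a real normed space. -/
noncomputable abbrev normedSpaceReal : NormedSpace ℝ M2 := normedAlgebraReal.toNormedSpace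

attribute [local instance] normTopology normedAlgebraReal normedSpaceReal

/-! ### Norms, entries and symplectic identities for 2 × 2 matrices -/

section MatrixNorm

theorem norm_entry_le (A : M2) (i j : Fin 2) : ‖A i j‖ ≤ ‖A‖ := by
  rw [Matrix.linfty_opNorm_def]
  have h : ‖A i j‖₊ ≤ Finset.univ.sup fun i : Fin 2 => ∑ j, ‖A i j‖₊ :=
    (Finset.single_le_sum (f := fun j => ‖A i j‖₊) (fun _ _ => zero_le)
      (Finset.mem_univ j)).trans
      (Finset.le_sup (f := fun i : Fin 2 => ∑ j, ‖A i j‖₊) (Finset.mem_univ i))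
  exact_mod_cast h

theorem norm_le_of_row_sums_le {A : M2} {c : ℝ} (h : ∀ i, ‖A i 0‖ + ‖A i 1‖ ≤ c) : ‖A‖ ≤ c := by
  have hc : 0 ≤ c := (add_nonneg (norm_nonneg _) (norm_nonneg _)).trans (h 0)
  lift c to NNReal using hc
  rw [Matrix.linfty_opNorm_def, NNReal.coe_le_coe]
  refine Finset.sup_le fun i _ => ?_
  rw [Fin.sum_univ_two]
  exact_mod_cast h i

/-- The entries of a matrix as continuous linear functionals. -/
noncomputable def entryCLM (i j : Fin 2) : M2 →L[ℝ] ℂ :=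
  LinearMap.toContinuousLinearMap (Matrix.entryLinearMap ℝ ℂ i j)

/-- Matrices with a single nonzero entry, as a continuous linear function of that entry. -/
noncomputable def singleCLM (i j : Fin 2) : ℂ →L[ℝ] M2 :=
  LinearMap.toContinuousLinearMap (Matrix.singleLinearMap ℝ i j)

@[simp] theorem singleCLM_apply (i j : Fin 2) (a : ℂ) : singleCLM i j a = Matrix.single i j a :=
  rfl

theorem sum_single_entry (A : M2) : Matrix.single 0 0 (A 0 0) + Matrix.single 0 1 (A 0 1)
    + Matrix.single 1 0 (A 1 0) + Matrix.single 1 1 (A 1 1) = A := by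
  ext i j
  fin_cases i <;> fin_cases j <;> simp

theorem isIntegralOf_matrix {F f : ℝ → M2}
    (h : ∀ i j, IsIntegralOf (fun x => F x i j) fun x => f x i j) : IsIntegralOf F f := by
  have := ((((h 0 0).clm_comp (singleCLM 0 0)).add ((h 0 1).clm_comp (singleCLM 0 1))).add
    ((h 1 0).clm_comp (singleCLM 1 0))).add ((h 1 1).clm_comp (singleCLM 1 1))
  simp only [singleCLM_apply] at this
  simpa only [sum_single_entry] using this

theorem IsIntegralOf.entry {F f : ℝ → M2} (h : IsIntegralOf F f) (i j : Fin 2) :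
    IsIntegralOf (fun x => F x i j) fun x => f x i j :=
  h.clm_comp (entryCLM i j)

theorem intervalIntegrable_matrix {f : ℝ → M2}
    (h : ∀ i j, ∀ a b : ℝ, IntervalIntegrable (fun x => f x i j) volume a b) (a b : ℝ) :
    IntervalIntegrable f volume a b :=
  (isIntegralOf_matrix (F := fun x => Matrix.of fun i j => 0 + ∫ t in (0 : ℝ)..x, f t i j)
    fun i j => .of_intervalIntegrable (h i j) 0).intervalIntegrable a b

theorem J_mul_J : J * J = -1 := by
  ext i j
  fin_cases i <;> fin_cases j <;> simp [J, Matrix.mul_apply]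

theorem J_mul_eq (A : M2) : J * A = !![A 1 0, A 1 1; -A 0 0, -A 0 1] := by
  ext i j
  fin_cases i <;> fin_cases j <;> simp [J, Matrix.mul_apply, Fin.sum_univ_two]

theorem mul_J_mul_entries (A G : M2) : A * J * G =
    !![A 0 0 * G 1 0 - A 0 1 * G 0 0, A 0 0 * G 1 1 - A 0 1 * G 0 1;
      A 1 0 * G 1 0 - A 1 1 * G 0 0, A 1 0 * G 1 1 - A 1 1 * G 0 1] := by
  ext i j
  fin_cases i <;> fin_cases j <;> simp [J, Matrix.mul_apply, Fin.sum_univ_two] <;> ring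

/-- The bilinear form of `J` is the determinant of two column vectors, which `A` multiplies by `det
A`. -/
theorem transpose_mul_J_mul (A : M2) : Aᵀ * J * A = A.det • J := by
  ext i j
  fin_cases i <;> fin_cases j <;>
    simp [J, Matrix.mul_apply, Fin.sum_univ_two, Matrix.det_fin_two] <;> ring

theorem mul_J_mul_transpose (A : M2) : A * J * Aᵀ = A.det • J := by
  ext i j
  fin_cases i <;> fin_cases j <;>
    simp [J, Matrix.mul_apply, Fin.sum_univ_two, Matrix.det_fin_two] <;> ring

/-- Transposition as a continuous linear map. -/
noncomputable def transposeCLM : M2 →L[ℝ] M2 :=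
  LinearMap.toContinuousLinearMap (Matrix.transposeLinearEquiv (Fin 2) (Fin 2) ℝ ℂ).toLinearMap

@[simp] theorem transposeCLM_apply (A : M2) : transposeCLM A = Aᵀ := rfl

/-- Entrywise conjugation as a continuous linear map. -/
noncomputable def conjCLM : M2 →L[ℝ] M2 :=
  LinearMap.toContinuousLinearMap
    { toFun := fun A => Aᴴᵀ
      map_add' := fun A B => by simp
      map_smul' := fun c A => by
        ext i j
        simp }

@[simp] theorem conjCLM_apply (A : M2) : conjCLM A = Aᴴᵀ := rfl

/-- Evaluation of a sesquilinear form, as a continuous linear functional. -/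
noncomputable def formCLM (v : Fin 2 → ℂ) : M2 →L[ℝ] ℂ :=
  LinearMap.toContinuousLinearMap
    { toFun := fun A => star v ⬝ᵥ (A *ᵥ v)
      map_add' := fun A B => by rw [add_mulVec, dotProduct_add]
      map_smul' := fun c A => by rw [smul_mulVec, dotProduct_smul]; rfl }

@[simp] theorem formCLM_apply (v : Fin 2 → ℂ) (A : M2) : formCLM v A = star v ⬝ᵥ (A *ᵥ v) := rfl

end MatrixNorm

/-- A real, symmetric, trace free, locally integrable potential `(p, r; r, -p)`. -/
structure DiracPotential where
  p : ℝ → ℝ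
  r : ℝ → ℝ
  p_int : ∀ a b : ℝ, IntervalIntegrable p volume a b
  r_int : ∀ a b : ℝ, IntervalIntegrable r volume a b

/-! ### The canonical Dirac system: Lagrange identity and dependence on the spectral parameter -/

namespace DiracPotential

/-- The matrix of the potential. -/
def mat (V : DiracPotential) (t : ℝ) : M2 := !![(V.p t : ℂ), V.r t; V.r t, -V.p t]

/-- The coefficient of `Y' = J (V - lam) Y`. -/
noncomputable def coef (V : DiracPotential) (lam : ℂ) (t : ℝ) : M2 := J * (V.mat t - lam • 1)

variable (V : DiracPotential)

theorem coef_eq (lam : ℂ) (t : ℝ) :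
    V.coef lam t = !![(V.r t : ℂ), -V.p t - lam; -V.p t + lam, -V.r t] := by
  ext i j
  fin_cases i <;> fin_cases j <;>
    simp [coef, mat, J, Matrix.mul_apply, Fin.sum_univ_two, sub_eq_neg_add]

theorem coef_intervalIntegrable (lam : ℂ) (a b : ℝ) :
    IntervalIntegrable (V.coef lam) volume a b := by
  have hp : ∀ a b : ℝ, IntervalIntegrable (fun t => (V.p t : ℂ)) volume a b := fun a b =>
    ⟨(V.p_int a b).1.ofReal, (V.p_int a b).2.ofReal⟩
  have hr : ∀ a b : ℝ, IntervalIntegrable (fun t => (V.r t : ℂ)) volume a b := fun a b =>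
    ⟨(V.r_int a b).1.ofReal, (V.r_int a b).2.ofReal⟩
  refine intervalIntegrable_matrix (fun i j a b => ?_) a b
  simp only [coef_eq]
  fin_cases i <;> fin_cases j
  · exact hr a b
  · exact (hp a b).neg.sub intervalIntegrable_const
  · exact (hp a b).neg.add intervalIntegrable_const
  · exact (hr a b).neg

/-- The fundamental solution of `Y' = J (V - lam) Y` with `Y 0 = 1`. -/
noncomputable def fund (lam : ℂ) : ℝ → M2 :=
  (exists_isIntegralOf_mul (V.coef_intervalIntegrable lam)).choose

theorem fund_zero (lam : ℂ) : V.fund lam 0 = 1 :=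
  (exists_isIntegralOf_mul (V.coef_intervalIntegrable lam)).choose_spec.1

theorem fund_isIntegralOf (lam : ℂ) :
    IsIntegralOf (V.fund lam) fun t => V.coef lam t * V.fund lam t :=
  (exists_isIntegralOf_mul (V.coef_intervalIntegrable lam)).choose_spec.2

theorem fund_continuous (lam : ℂ) : Continuous (V.fund lam) := (V.fund_isIntegralOf lam).continuous

theorem eq_fund_mul {lam : ℂ} {Y : ℝ → M2} (hY : IsIntegralOf Y fun t => V.coef lam t * Y t)
    {x : ℝ} (hx : 0 ≤ x) : Y x = V.fund lam x * Y 0 := by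
  refine hY.eq_of_mul (V.coef_intervalIntegrable lam)
    (Z := fun x => V.fund lam x * Y 0) ?_ (by simp [fund_zero]) hx
  simpa only [mul_assoc] using (V.fund_isIntegralOf lam).mul_const (Y 0)

/-- The Lagrange identity. -/
theorem lagrange_isIntegralOf (lam mu : ℂ) :
    IsIntegralOf (fun x => (V.fund mu x)ᵀ * J * V.fund lam x)
      fun x => (lam - mu) • ((V.fund mu x)ᵀ * V.fund lam x) := by
  have h := (((V.fund_isIntegralOf mu).clm_comp transposeCLM).mul_const J).mul
    (V.fund_isIntegralOf lam)
  simp only [transposeCLM_apply] at h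
  convert h using 1
  funext x
  -- The symmetric potential drops out, since `Jᵀ J = 1` and `J J = -1`. Using the transpose instead
  -- of the adjoint keeps the identity holomorphic in both parameters.
  have e : (V.coef mu x)ᵀ * J + J * V.coef lam x = (lam - mu) • 1 := by
    rw [coef_eq, coef_eq]
    ext i j
    fin_cases i <;> fin_cases j <;>
      simp [J, Matrix.mul_apply, Fin.sum_univ_two] <;> ring
  rw [transpose_mul]
  calc _ = (V.fund mu x)ᵀ * ((lam - mu) • 1) * V.fund lam x := by simp
    _ = _ := by rw [← e]; noncomm_ring

theorem lagrange (lam mu : ℂ) (x : ℝ) :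
    (V.fund mu x)ᵀ * J * V.fund lam x =
      J + (lam - mu) • ∫ t in (0 : ℝ)..x, (V.fund mu t)ᵀ * V.fund lam t := by
  rw [(V.lagrange_isIntegralOf lam mu).eq_add x, intervalIntegral.integral_smul]
  simp [fund_zero]

theorem det_fund (lam : ℂ) (x : ℝ) : (V.fund lam x).det = 1 := by
  have h := V.lagrange lam lam x
  rw [transpose_mul_J_mul, sub_self, zero_smul, add_zero] at h
  simpa [J] using congrFun (congrFun h 0) 1

/-- The potential is real, so conjugating the equation only conjugates the spectral parameter. -/
theorem fund_conj (lam : ℂ) {x : ℝ} (hx : 0 ≤ x) :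
    V.fund (starRingEnd ℂ lam) x = (V.fund lam x)ᴴᵀ := by
  have h := (V.fund_isIntegralOf lam).clm_comp conjCLM
  simp only [conjCLM_apply] at h
  have h' : IsIntegralOf (fun x => (V.fund lam x)ᴴᵀ)
      fun t => V.coef (starRingEnd ℂ lam) t * (V.fund lam t)ᴴᵀ := by
    convert h using 2 with t
    rw [conjTranspose_mul, transpose_mul]
    congr 1
    rw [coef_eq, coef_eq]
    ext i j
    fin_cases i <;> fin_cases j <;> simp
  have := V.eq_fund_mul h' hx
  rw [this, fund_zero]
  simp

theorem fund_conj_transpose (lam : ℂ) {x : ℝ} (hx : 0 ≤ x) :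
    (V.fund (starRingEnd ℂ lam) x)ᵀ = (V.fund lam x)ᴴ := by
  rw [V.fund_conj lam hx, transpose_transpose]

theorem fund_im_eq_zero {lam : ℂ} (hl : lam.im = 0) {x : ℝ} (hx : 0 ≤ x) (i j : Fin 2) :
    (V.fund lam x i j).im = 0 := by
  have h := V.fund_conj lam hx
  rw [Complex.conj_eq_iff_im.2 hl] at h
  have := congrFun (congrFun h i) j
  simp only [transpose_apply, conjTranspose_apply] at this
  exact Complex.conj_eq_iff_im.1 this.symm

/-- The Gram matrix of the columns of the fundamental solution on `[0, x]`. -/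
noncomputable def gram (lam : ℂ) (x : ℝ) : M2 :=
  ∫ t in (0 : ℝ)..x, (V.fund (starRingEnd ℂ lam) t)ᵀ * V.fund lam t

/-- The form is the integral of `|M(t) v|²`, and `M(t) v` never vanishes because `det M = 1`. This
positivity yields real eigenvalues and both multiplicity statements. -/
theorem gram_re_pos (lam : ℂ) {x : ℝ} (hx : 0 < x) {v : Fin 2 → ℂ} (hv : v ≠ 0) :
    0 < (star v ⬝ᵥ (V.gram lam x *ᵥ v)).re := by
  have hc : Continuous fun t => (V.fund (starRingEnd ℂ lam) t)ᵀ * V.fund lam t :=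
    (transposeCLM.continuous.comp (V.fund_continuous _)).mul (V.fund_continuous _)
  have e : (star v ⬝ᵥ (V.gram lam x *ᵥ v)).re = ∫ t in (0 : ℝ)..x,
      (Complex.reCLM.comp (formCLM v)) ((V.fund (starRingEnd ℂ lam) t)ᵀ * V.fund lam t) := by
    rw [ContinuousLinearMap.intervalIntegral_comp_comm _ (hc.intervalIntegrable 0 x)]
    rfl
  rw [e]
  refine intervalIntegral_pos_of_pos_on
    (((Complex.reCLM.comp (formCLM v)).continuous.comp hc).intervalIntegrable 0 x)
    (fun t ht => ?_) hx
  rw [V.fund_conj_transpose lam ht.1.le]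
  simp only [ContinuousLinearMap.comp_apply, formCLM_apply, Complex.reCLM_apply]
  rw [← mulVec_mulVec, dotProduct_mulVec, ← star_mulVec]
  have hne : V.fund lam t *ᵥ v ≠ 0 := fun h0 => hv <| by
    by_contra hv0
    have := (exists_mulVec_eq_zero_iff (M := V.fund lam t)).1 ⟨v, hv0, h0⟩
    rw [V.det_fund] at this
    exact one_ne_zero this
  set w := V.fund lam t *ᵥ v
  have hs : (star w ⬝ᵥ w).re = Complex.normSq (w 0) + Complex.normSq (w 1) := by
    simp [dotProduct, Fin.sum_univ_two, Complex.normSq_apply]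
  rw [hs]
  by_contra hle
  have h0 : Complex.normSq (w 0) = 0 := by
    linarith [Complex.normSq_nonneg (w 0), Complex.normSq_nonneg (w 1)]
  have h1 : Complex.normSq (w 1) = 0 := by
    linarith [Complex.normSq_nonneg (w 0), Complex.normSq_nonneg (w 1)]
  refine hne ?_
  ext i
  fin_cases i
  · exact Complex.normSq_eq_zero.1 h0
  · exact Complex.normSq_eq_zero.1 h1

/-- Periodic eigenvalues are real. -/
theorem im_eq_zero_of_trace_eq_two {lam : ℂ} {x : ℝ} (hx : 0 < x)
    (h : (V.fund lam x).trace = 2) : lam.im = 0 := by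
  -- For determinant one, `det (M - 1) = 2 - tr M`, so trace two makes `1` an eigenvalue.
  have hdet : (V.fund lam x - 1).det = 0 := by
    have h1 := V.det_fund lam x
    rw [det_fin_two] at h1
    rw [trace_fin_two] at h
    simp [det_fin_two]
    linear_combination h1 - h
  obtain ⟨v, hv, hv0⟩ := exists_mulVec_eq_zero_iff.2 hdet
  rw [sub_mulVec, one_mulVec, sub_eq_zero] at hv0
  have hL := V.lagrange lam (starRingEnd ℂ lam) x
  rw [V.fund_conj_transpose lam hx.le, ← gram] at hL
  -- The Lagrange identity for `lam` and its conjugate is evaluated at the fixed vector `v`: the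
  -- boundary terms cancel and leave the Gram form times `lam - conj lam`.
  have h2 := congrArg (fun A => star v ⬝ᵥ (A *ᵥ v)) hL
  simp only [add_mulVec, dotProduct_add, smul_mulVec, dotProduct_smul] at h2
  rw [← mulVec_mulVec, hv0, ← mulVec_mulVec, dotProduct_mulVec, ← star_mulVec, hv0] at h2
  have h3 : (lam - starRingEnd ℂ lam) * (star v ⬝ᵥ (V.gram lam x *ᵥ v)) = 0 := by
    simpa using h2.symm
  rcases mul_eq_zero.1 h3 with h4 | h4
  · exact Complex.conj_eq_iff_im.1 (sub_eq_zero.1 h4).symm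
  · have := V.gram_re_pos lam hx hv
    rw [h4] at this
    simp at this

theorem norm_coef_le (lam : ℂ) (t : ℝ) : ‖V.coef lam t‖ ≤ (|V.p t| + |V.r t|) + ‖lam‖ := by
  rw [coef_eq]
  refine norm_le_of_row_sums_le fun i => ?_
  fin_cases i
  · simp only [Fin.zero_eta, of_apply, cons_val', cons_val_zero, cons_val_one, cons_val_fin_one]
    have := norm_sub_le (-(V.p t : ℂ)) lam
    rw [norm_neg] at this
    simp only [Complex.norm_real, Real.norm_eq_abs] at *
    linarith
  · simp only [Fin.mk_one, of_apply, cons_val', cons_val_zero, cons_val_one, cons_val_fin_one]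
    have := norm_add_le (-(V.p t : ℂ)) lam
    rw [norm_neg] at this ⊢
    simp only [Complex.norm_real, Real.norm_eq_abs] at *
    linarith

theorem exists_norm_fund_le (R l : ℝ) :
    ∃ C, 0 ≤ C ∧ ∀ lam : ℂ, ‖lam‖ ≤ R → ∀ x ∈ Icc 0 l, ‖V.fund lam x‖ ≤ C := by
  refine ⟨‖(1 : M2)‖ * Real.exp (∫ t in (0 : ℝ)..l, ((|V.p t| + |V.r t|) + |R|)), by positivity,
    fun lam hl x hx => ?_⟩
  have hi : ∀ a b : ℝ, IntervalIntegrable (fun t => (|V.p t| + |V.r t|) + |R|) volume a b :=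
    fun a b => ((V.p_int a b).abs.add (V.r_int a b).abs).add intervalIntegrable_const
  refine ((V.fund_isIntegralOf lam).norm_le_of_mul (V.coef_intervalIntegrable lam) hx.1).trans ?_
  rw [fund_zero]
  gcongr
  calc ∫ t in (0 : ℝ)..x, ‖V.coef lam t‖ ≤ ∫ t in (0 : ℝ)..x, ((|V.p t| + |V.r t|) + |R|) :=
        integral_mono_on hx.1 (V.coef_intervalIntegrable lam 0 x).norm (hi 0 x) fun t _ =>
          (V.norm_coef_le lam t).trans (by linarith [le_abs_self R])
    _ ≤ _ := integral_mono_interval le_rfl hx.1 hx.2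
        (Eventually.of_forall fun t => by positivity) (hi 0 l)

/-- Solving the Lagrange identity for `M_lam` by means of `M_mu J M_muᵀ = J` gives an exact
difference quotient, so continuity and then complex differentiability in the parameter reduce to
limits under the integral. -/
theorem fund_sub_fund (lam mu : ℂ) (x : ℝ) : V.fund lam x - V.fund mu x =
    (lam - mu) • -(V.fund mu x * J * ∫ t in (0 : ℝ)..x, (V.fund mu t)ᵀ * V.fund lam t) := by
  have h := V.lagrange lam mu x
  have h2 := mul_J_mul_transpose (V.fund mu x)
  rw [V.det_fund, one_smul] at h2
  rw [smul_neg, ← mul_smul_comm, ← sub_eq_iff_eq_add'.2 h, mul_sub]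
  calc _ = (-1 : M2) * -(V.fund lam x) + V.fund mu x * (-1) := by noncomm_ring
    _ = _ := by
      rw [← J_mul_J]
      nth_rewrite 1 [← h2]
      noncomm_ring

theorem tendsto_fund (mu : ℂ) {x : ℝ} (hx : 0 ≤ x) :
    Tendsto (fun lam => V.fund lam x) (𝓝 mu) (𝓝 (V.fund mu x)) := by
  obtain ⟨C, hC0, hC⟩ := V.exists_norm_fund_le (‖mu‖ + 1) x
  obtain ⟨D, hD⟩ := (isCompact_Icc (a := (0 : ℝ)) (b := x)).exists_bound_of_continuousOn
    (transposeCLM.continuous.comp (V.fund_continuous mu)).continuousOn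
  rw [tendsto_iff_norm_sub_tendsto_zero]
  have hz : Tendsto (fun lam => ‖lam - mu‖ * (‖V.fund mu x * J‖ * ((D * C) * |x - 0|))) (𝓝 mu)
      (𝓝 0) := by
    have : Tendsto (fun lam : ℂ => ‖lam - mu‖) (𝓝 mu) (𝓝 0) :=
      tendsto_iff_norm_sub_tendsto_zero.1 tendsto_id
    simpa using this.mul_const (‖V.fund mu x * J‖ * ((D * C) * |x - 0|))
  refine squeeze_zero' (Eventually.of_forall fun _ => norm_nonneg _) ?_ hz
  filter_upwards [Metric.ball_mem_nhds mu one_pos] with lam hlam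
  have hl : ‖lam‖ ≤ ‖mu‖ + 1 := by
    have := norm_le_norm_add_norm_sub' lam mu
    rw [Metric.mem_ball, dist_eq_norm] at hlam
    linarith
  rw [V.fund_sub_fund, norm_smul, norm_neg]
  gcongr
  refine (norm_mul_le _ _).trans ?_
  gcongr
  refine norm_integral_le_of_norm_le_const fun t ht => (norm_mul_le _ _).trans ?_
  rw [uIoc_of_le hx] at ht
  exact mul_le_mul (hD t ⟨ht.1.le, ht.2⟩) (hC lam hl t ⟨ht.1.le, ht.2⟩) (norm_nonneg _)
    ((norm_nonneg _).trans (hD t ⟨ht.1.le, ht.2⟩))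

/-- The fundamental solution is an entire function of the spectral parameter. -/
theorem hasDerivAt_fund (mu : ℂ) {x : ℝ} (hx : 0 ≤ x) :
    HasDerivAt (fun lam => V.fund lam x)
      (-(V.fund mu x * J * ∫ t in (0 : ℝ)..x, (V.fund mu t)ᵀ * V.fund mu t)) mu := by
  rw [hasDerivAt_iff_tendsto_slope]
  obtain ⟨C, hC0, hC⟩ := V.exists_norm_fund_le (‖mu‖ + 1) x
  obtain ⟨D, hD⟩ := (isCompact_Icc (a := (0 : ℝ)) (b := x)).exists_bound_of_continuousOn
    (transposeCLM.continuous.comp (V.fund_continuous mu)).continuousOn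
  -- Dominated convergence, with Gronwall's bound uniform over the unit disc around `mu`.
  have hI : ContinuousAt (fun lam => ∫ t in (0 : ℝ)..x, (V.fund mu t)ᵀ * V.fund lam t) mu := by
    refine continuousAt_of_dominated_interval (bound := fun _ => D * C)
      (Eventually.of_forall fun lam => ?_) ?_ intervalIntegrable_const
      (Eventually.of_forall fun t ht => ?_)
    · exact ((transposeCLM.continuous.comp (V.fund_continuous mu)).mul
        (V.fund_continuous lam)).aestronglyMeasurable
    · filter_upwards [Metric.ball_mem_nhds mu one_pos] with lam hlam
      have hl : ‖lam‖ ≤ ‖mu‖ + 1 := by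
        have := norm_le_norm_add_norm_sub' lam mu
        rw [Metric.mem_ball, dist_eq_norm] at hlam
        linarith
      refine Eventually.of_forall fun t ht => (norm_mul_le _ _).trans ?_
      rw [uIoc_of_le hx] at ht
      exact mul_le_mul (hD t ⟨ht.1.le, ht.2⟩) (hC lam hl t ⟨ht.1.le, ht.2⟩) (norm_nonneg _)
        ((norm_nonneg _).trans (hD t ⟨ht.1.le, ht.2⟩))
    · rw [uIoc_of_le hx] at ht
      exact (V.tendsto_fund mu ht.1.le).const_mul _
  have hlim := ((hI.tendsto.const_mul (V.fund mu x * J)).neg).mono_left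
    (nhdsWithin_le_nhds (s := {mu}ᶜ))
  refine hlim.congr' ?_
  filter_upwards [self_mem_nhdsWithin] with lam hlam
  rw [slope_def_module, V.fund_sub_fund lam mu x, smul_smul,
    inv_mul_cancel₀ (sub_ne_zero.2 hlam), one_smul]

theorem differentiable_fund_entry {x : ℝ} (hx : 0 ≤ x) (i j : Fin 2) :
    Differentiable ℂ fun lam => V.fund lam x i j := fun mu =>
  ((LinearMap.toContinuousLinearMap (Matrix.entryLinearMap ℂ ℂ i j)).hasFDerivAt.comp_hasDerivAt mu
    (V.hasDerivAt_fund mu hx)).differentiableAt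

theorem hasDerivAt_fund_entry {lam : ℂ} (hl : lam.im = 0) {x : ℝ} (hx : 0 ≤ x) (i j : Fin 2) :
    HasDerivAt (fun lam => V.fund lam x i j) (-(V.fund lam x * J * V.gram lam x) i j) lam := by
  have h := (LinearMap.toContinuousLinearMap
    (Matrix.entryLinearMap ℂ ℂ i j)).hasFDerivAt.comp_hasDerivAt lam (V.hasDerivAt_fund lam hx)
  rw [gram, Complex.conj_eq_iff_im.2 hl]
  exact h

end DiracPotential

end SelfAdjointSystem

namespace SelfAdjointSystem

attribute [local instance] Matrix.linftyOpNormedRing Matrix.linftyOpNormedAlgebra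
attribute [local instance] normTopology normedAlgebraReal normedSpaceReal

/-! ### The discriminant and the multiplicity of periodic eigenvalues -/

namespace DiracPotential

variable (V : DiracPotential)

/-- The discriminant of the system over the period `π`. -/
noncomputable def disc (lam : ℂ) : ℂ := (V.fund lam Real.pi).trace

theorem gram_form_pos (lam : ℂ) {x : ℝ} (hx : 0 < x) {a b : ℝ} (hab : a ≠ 0 ∨ b ≠ 0) :
    0 < (V.gram lam x 0 0).re * a ^ 2 + (V.gram lam x 0 1 + V.gram lam x 1 0).re * (a * b)
      + (V.gram lam x 1 1).re * b ^ 2 := by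
  have hv : (![(a : ℂ), (b : ℂ)] : Fin 2 → ℂ) ≠ 0 := fun h => by
    have h0 := congrFun h 0
    have h1 := congrFun h 1
    simp at h0 h1
    tauto
  have h := V.gram_re_pos lam hx hv
  refine h.trans_eq ?_
  simp [dotProduct, mulVec, Fin.sum_univ_two]
  ring

theorem gram_symm {lam : ℂ} (hl : lam.im = 0) (x : ℝ) : V.gram lam x 0 1 = V.gram lam x 1 0 := by
  have hc : Continuous fun t => (V.fund lam t)ᵀ * V.fund lam t :=
    (transposeCLM.continuous.comp (V.fund_continuous _)).mul (V.fund_continuous _)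
  have h : (V.gram lam x)ᵀ = V.gram lam x := by
    rw [gram, Complex.conj_eq_iff_im.2 hl, ← transposeCLM_apply,
      ← ContinuousLinearMap.intervalIntegral_comp_comm _ (hc.intervalIntegrable 0 x)]
    simp
  exact congrFun (congrFun h 1) 0

theorem fund_ofReal_re {lam : ℂ} (hl : lam.im = 0) {x : ℝ} (hx : 0 ≤ x) (i j : Fin 2) :
    V.fund lam x i j = ((V.fund lam x i j).re : ℂ) :=
  Complex.ext rfl (by simpa using V.fund_im_eq_zero hl hx i j)

/-- Since `J V = -V J`, multiplication by `J` undoes the sign change caused by the translation, so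
`J M(x + l)` solves the original equation. -/
theorem J_mul_fund_add {l : ℝ} (hV : ∀ᵐ x, V.mat (x + l) = -V.mat x) (lam : ℂ) {x : ℝ}
    (hx : 0 ≤ x) : J * V.fund lam (x + l) = V.fund lam x * (J * V.fund lam l) := by
  have h := ((V.fund_isIntegralOf lam).comp_add_right l).const_mul J
  have h' : IsIntegralOf (fun x => J * V.fund lam (x + l))
      fun t => V.coef lam t * (J * V.fund lam (t + l)) := by
    refine h.congr_ae ?_
    filter_upwards [hV] with t ht
    have key : J * (J * (-V.mat t - lam • 1)) = J * (V.mat t - lam • 1) * J := by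
      rw [J_mul_eq, J_mul_eq, J_mul_eq]
      ext i j
      fin_cases i <;> fin_cases j <;> simp [J, mat, Matrix.mul_apply, Fin.sum_univ_two]
    rw [coef, coef, ht, ← mul_assoc J (J * _), key, mul_assoc _ J]
  have := V.eq_fund_mul h' hx
  simpa using this

/-- The antisymmetric part of the transfer matrix over `[0, l]`. -/
noncomputable def skew (l : ℝ) (lam : ℂ) : ℂ := V.fund lam l 0 1 - V.fund lam l 1 0

/-- With `M = M(π/2)` one has `M(π) = -J M J M`, whose trace is `2 m₁₁ m₂₂ - m₁₂² - m₂₁²`;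
subtracting `2 det M = 2` leaves a square. -/
theorem disc_sub_two_eq (hV : ∀ᵐ x, V.mat (x + Real.pi / 2) = -V.mat x) (lam : ℂ) :
    V.disc lam - 2 = (Complex.I * V.skew (Real.pi / 2) lam) ^ 2 := by
  have hp : 0 ≤ Real.pi / 2 := by positivity
  have h := V.J_mul_fund_add hV lam hp
  rw [add_halves] at h
  have h2 : V.fund lam Real.pi =
      -(J * (V.fund lam (Real.pi / 2) * (J * V.fund lam (Real.pi / 2)))) := by
    rw [← h, ← mul_assoc, J_mul_J]
    simp
  have hd := V.det_fund lam (Real.pi / 2)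
  rw [det_fin_two] at hd
  rw [disc, h2, skew, mul_pow, Complex.I_sq, trace_fin_two]
  simp only [J_mul_eq, Matrix.mul_apply, Fin.sum_univ_two, Matrix.neg_apply, of_apply, cons_val',
    cons_val_zero, cons_val_one, cons_val_fin_one]
  linear_combination 2 * hd

/-- At a real zero `M` is a real symmetric matrix `(a, b; b, d)` with `a d - b² = 1`, hence
definite. Up to sign the derivative is the trace of its adjugate times the positive Gram matrix,
which cannot vanish. -/
theorem skew_hasDerivAt_re_ne_zero {lam : ℂ} (hl : lam.im = 0) {l : ℝ} (hp : 0 < l)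
    (h0 : V.skew l lam = 0) : ∃ d : ℂ, d ≠ 0 ∧ HasDerivAt (V.skew l) d lam := by
  refine ⟨_, ?_, (V.hasDerivAt_fund_entry hl hp.le 0 1).sub
    (V.hasDerivAt_fund_entry hl hp.le 1 0)⟩
  intro hd
  have hre := congrArg Complex.re hd
  have hdet := congrArg Complex.re (V.det_fund lam l)
  rw [skew, sub_eq_zero] at h0
  rw [det_fin_two] at hdet
  rw [mul_J_mul_entries] at hre
  rw [← h0, V.fund_ofReal_re hl hp.le 0 0, V.fund_ofReal_re hl hp.le 0 1,
    V.fund_ofReal_re hl hp.le 1 1] at hre hdet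
  simp at hre hdet
  set a := (V.fund lam l 0 0).re
  set b := (V.fund lam l 0 1).re
  set d := (V.fund lam l 1 1).re
  have ha : a ≠ 0 := fun ha => by rw [ha] at hdet; nlinarith [sq_nonneg b]
  -- Multiplied by `a`, minus the derivative is the sum of the Gram form at `(-b, a)` and at `(1,
  -- 0)`, because `a d = 1 + b²`.
  have h1 := V.gram_form_pos lam hp (a := -b) (b := a) (Or.inr ha)
  have h2 := V.gram_form_pos lam hp (a := 1) (b := 0) (Or.inl one_ne_zero)
  simp at h1 h2
  have : a * (a * (V.gram lam l 1 1).re + d * (V.gram lam l 0 0).re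
      - b * ((V.gram lam l 0 1).re + (V.gram lam l 1 0).re)) = 0 := by
    rw [show a * (V.gram lam l 1 1).re + d * (V.gram lam l 0 0).re
      - b * ((V.gram lam l 0 1).re + (V.gram lam l 1 0).re) = 0 by linarith, mul_zero]
  have h3 : a * d * (V.gram lam l 0 0).re = (1 + b * b) * (V.gram lam l 0 0).re := by
    rw [← hdet]; ring
  nlinarith

theorem differentiable_skew {l : ℝ} (hl : 0 ≤ l) : Differentiable ℂ (V.skew l) :=
  (V.differentiable_fund_entry hl 0 1).sub (V.differentiable_fund_entry hl 1 0)

/-- If the potential is antiperiodic over the half period, all periodic eigenvalues are double. -/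
theorem onlyDoubleZeros_of_antiperiodic (hV : ∀ᵐ x, V.mat (x + Real.pi / 2) = -V.mat x) :
    OnlyDoubleZeros fun lam => V.disc lam - 2 := by
  intro lam h0
  have hp : 0 < Real.pi / 2 := by positivity
  have hl : lam.im = 0 := V.im_eq_zero_of_trace_eq_two Real.pi_pos (sub_eq_zero.1 h0)
  have hs : V.skew (Real.pi / 2) lam = 0 := by
    have : V.disc lam - 2 = 0 := h0
    rw [V.disc_sub_two_eq hV] at this
    simpa using this
  obtain ⟨d, hd, hder⟩ := V.skew_hasDerivAt_re_ne_zero hl hp hs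
  have hder' := hder.const_mul Complex.I
  have han : AnalyticAt ℂ (fun lam => Complex.I * V.skew (Real.pi / 2) lam) lam :=
    ((V.differentiable_skew hp.le).const_mul Complex.I).analyticAt lam
  have h1 := han.analyticOrderAt_eq_one_of_zero_deriv_ne_zero (by simp [hs])
    (by rw [hder'.deriv]; exact mul_ne_zero Complex.I_ne_zero hd)
  have e : (fun lam => V.disc lam - 2) = (fun lam => Complex.I * V.skew (Real.pi / 2) lam) ^ 2 :=
    funext fun lam => V.disc_sub_two_eq hV lam
  rw [e, analyticOrderAt_pow han, h1]
  rfl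

theorem differentiable_disc : Differentiable ℂ V.disc := by
  have e : V.disc = fun lam => V.fund lam Real.pi 0 0 + V.fund lam Real.pi 1 1 :=
    funext fun lam => trace_fin_two _
  rw [e]
  exact (V.differentiable_fund_entry Real.pi_pos.le 0 0).add
    (V.differentiable_fund_entry Real.pi_pos.le 1 1)

/-- At a multiple periodic eigenvalue all solutions are periodic. -/
theorem fund_eq_one_of_deriv_disc_eq_zero {lam : ℂ} (h : V.disc lam = 2)
    (h' : deriv V.disc lam = 0) : V.fund lam Real.pi = 1 := by
  have hp := Real.pi_pos
  have hl : lam.im = 0 := V.im_eq_zero_of_trace_eq_two hp h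
  have e : V.disc = fun lam => V.fund lam Real.pi 0 0 + V.fund lam Real.pi 1 1 :=
    funext fun lam => trace_fin_two _
  have hd := (V.hasDerivAt_fund_entry hl hp.le 0 0).add (V.hasDerivAt_fund_entry hl hp.le 1 1)
  rw [show V.disc = (fun lam => V.fund lam Real.pi 0 0) + fun lam => V.fund lam Real.pi 1 1 from e,
    hd.deriv] at h'
  have hre := congrArg Complex.re h'
  have htr := congrArg Complex.re h
  have hdet := congrArg Complex.re (V.det_fund lam Real.pi)
  rw [e] at htr
  rw [det_fin_two] at hdet
  rw [mul_J_mul_entries] at hre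
  rw [V.fund_ofReal_re hl hp.le 0 0, V.fund_ofReal_re hl hp.le 0 1, V.fund_ofReal_re hl hp.le 1 0,
    V.fund_ofReal_re hl hp.le 1 1] at hre hdet
  rw [V.gram_symm hl] at hre
  simp at hre hdet htr
  have hq := fun a b => V.gram_form_pos lam hp (a := a) (b := b)
  rw [V.gram_symm hl] at hq
  simp at hq
  set a := (V.fund lam Real.pi 0 0).re with ha
  set b := (V.fund lam Real.pi 0 1).re with hb
  set c := (V.fund lam Real.pi 1 0).re with hc
  set d := (V.fund lam Real.pi 1 1).re with hdd
  set g := (V.gram lam Real.pi 1 0).re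
  set g0 := (V.gram lam Real.pi 0 0).re
  set g1 := (V.gram lam Real.pi 1 1).re
  have hda : d = 2 - a := by linarith
  rw [hda] at hdet hre
  -- Trace two and determinant one give `hn`; `hz` is the vanishing derivative. By these, the Gram
  -- form at `(b, 1 - a)` equals `-b` times the left side of `hz`, so it is zero and `b = 0`. Then
  -- `a = 1`, and `hz` becomes `c g1 = 0` with `g1 > 0`.
  have hn : (a - 1) ^ 2 = -(b * c) := by linear_combination -hdet
  have hz : 2 * (a - 1) * g - b * g0 + c * g1 = 0 := by linear_combination -hre
  have hb0 : b = 0 := by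
    by_contra hne
    have := hq b (-(a - 1)) (Or.inl hne)
    have e2 : g0 * b ^ 2 + (g + g) * (b * -(a - 1)) + g1 * (-(a - 1)) ^ 2
        = -b * (2 * (a - 1) * g - b * g0 + c * g1) := by
      rw [neg_sq, hn]; ring
    rw [e2, hz] at this
    simp at this
  have ha1 : a = 1 := by
    rw [hb0, zero_mul, neg_zero] at hn
    linarith [pow_eq_zero_iff (two_ne_zero) |>.1 hn]
  have hc0 : c = 0 := by
    by_contra hne
    have := hq 0 c (Or.inr hne)
    rw [ha1, hb0] at hz
    have e2 : c * g1 = 0 := by linarith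
    have : g1 * c ^ 2 = 0 := by rw [pow_two]; linear_combination c * e2
    linarith
  ext i j
  rw [V.fund_ofReal_re hl hp.le i j]
  fin_cases i <;> fin_cases j <;> simp [← ha, ← hb, ← hc, ← hdd, ha1, hb0, hc0]
  linarith

end DiracPotential

end SelfAdjointSystem

namespace SelfAdjointSystem

attribute [local instance] Matrix.linftyOpNormedRing Matrix.linftyOpNormedAlgebra
attribute [local instance] normTopology normedAlgebraReal normedSpaceReal

/-! ### A Riemann-Lebesgue lemma for complex frequencies, uniform in the endpoint -/

section RiemannLebesgue

/-- Polynomials are dense in `L¹(0, l)`. -/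
theorem exists_polynomial_integral_abs_sub_le {q : ℝ → ℝ} {l : ℝ} (hl : 0 ≤ l)
    (hq : IntervalIntegrable q volume 0 l) {ε : ℝ} (hε : 0 < ε) :
    ∃ P : Polynomial ℝ, ∫ t in (0 : ℝ)..l, |q t - P.eval t| ≤ ε := by
  have hind : Integrable ((Ioc 0 l).indicator q) volume :=
    ((intervalIntegrable_iff_integrableOn_Ioc_of_le hl).1 hq).integrable_indicator measurableSet_Ioc
  obtain ⟨g, -, hg, hgc, hgi⟩ := hind.exists_hasCompactSupport_integral_sub_le (half_pos hε)
  -- The denominator `l + 1` instead of `l` covers the degenerate interval `l = 0`.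
  obtain ⟨P, hP⟩ := exists_polynomial_near_of_continuousOn 0 l g hgc.continuousOn
    (ε / 2 / (l + 1)) (by positivity)
  refine ⟨P, ?_⟩
  have h1 : IntervalIntegrable (fun t => |q t - g t|) volume 0 l :=
    (hq.sub (hgc.intervalIntegrable 0 l)).abs
  have h2 : IntervalIntegrable (fun t => |g t - P.eval t|) volume 0 l :=
    ((hgc.sub P.continuous).abs).intervalIntegrable 0 l
  calc ∫ t in (0 : ℝ)..l, |q t - P.eval t|
      ≤ ∫ t in (0 : ℝ)..l, (|q t - g t| + |g t - P.eval t|) :=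
        integral_mono_on hl (hq.sub (P.continuous.intervalIntegrable 0 l)).abs (h1.add h2)
          fun t _ => abs_sub_le _ _ _
    _ = (∫ t in (0 : ℝ)..l, |q t - g t|) + ∫ t in (0 : ℝ)..l, |g t - P.eval t| :=
        integral_add h1 h2
    _ ≤ ε / 2 + ε / 2 := by
        refine add_le_add ?_ ?_
        · refine le_trans ?_ hg
          rw [integral_of_le hl]
          calc ∫ t in Ioc 0 l, |q t - g t|
              = ∫ t in Ioc 0 l, ‖(Ioc 0 l).indicator q t - g t‖ := by
                refine setIntegral_congr_fun measurableSet_Ioc fun t ht => ?_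
                simp [indicator_of_mem ht]
            _ ≤ _ := setIntegral_le_integral (hind.sub hgi).norm
                (Eventually.of_forall fun t => norm_nonneg _)
        · calc ∫ t in (0 : ℝ)..l, |g t - P.eval t| ≤ ∫ t in (0 : ℝ)..l, ε / 2 / (l + 1) :=
                integral_mono_on hl h2 intervalIntegrable_const fun t ht => by
                  rw [abs_sub_comm]; exact (hP t ht).le
            _ = ε / 2 * (l / (l + 1)) := by
                rw [intervalIntegral.integral_const, smul_eq_mul]; ring
            _ ≤ ε / 2 * 1 := by
                gcongr
                rw [div_le_one (by positivity)]
                linarith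
            _ = ε / 2 := mul_one _
    _ = ε := add_halves ε

theorem norm_exp_phase_le (lam : ℂ) {x t : ℝ} (ht : t ∈ Icc 0 x) :
    ‖Complex.exp (Complex.I * lam * (2 * t - x))‖ ≤ Real.exp (|lam.im| * x) := by
  rw [Complex.norm_exp, Real.exp_le_exp]
  have : (Complex.I * lam * (2 * t - x)).re = lam.im * (x - 2 * t) := by
    simp [Complex.mul_re]
    ring
  rw [this]
  refine (le_abs_self _).trans ?_
  rw [abs_mul]
  refine mul_le_mul_of_nonneg_left (abs_le.2 ⟨?_, ?_⟩) (abs_nonneg _) <;> linarith [ht.1, ht.2]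

/-- One integration by parts gains the factor `1 / |lam|`; the phase costs at most `exp(|Im lam|
x)`, since `|2 t - x| ≤ x` on `[0, x]`. -/
theorem norm_integral_phase_mul_polynomial_le (P : Polynomial ℝ) (l : ℝ) :
    ∃ C, 0 ≤ C ∧ ∀ lam : ℂ, lam ≠ 0 → ∀ x ∈ Icc 0 l,
      ‖∫ t in (0 : ℝ)..x, Complex.exp (Complex.I * lam * (2 * t - x)) * (P.eval t : ℝ)‖
        ≤ C / ‖lam‖ * Real.exp (|lam.im| * x) := by
  obtain ⟨M, hM⟩ := (isCompact_Icc (a := (0 : ℝ)) (b := l)).exists_bound_of_continuousOn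
    P.continuous.continuousOn
  obtain ⟨N, hN⟩ := (isCompact_Icc (a := (0 : ℝ)) (b := l)).exists_bound_of_continuousOn
    P.derivative.continuous.continuousOn
  refine ⟨|M| + |M| + |N| * |l|, by positivity, fun lam hlam x hx => ?_⟩
  set E := Real.exp (|lam.im| * x) with hE
  have hE0 : 0 < E := Real.exp_pos _
  have hc : (2 * (Complex.I * lam)) ≠ 0 := by simp [hlam]
  set F : ℝ → ℂ := fun t => Complex.exp (Complex.I * lam * (2 * t - x)) / (2 * (Complex.I * lam))
    with hF
  have hFd : ∀ t : ℝ, HasDerivAt F (Complex.exp (Complex.I * lam * (2 * t - x))) t := fun t => by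
    have h1 : HasDerivAt (fun t : ℝ => (t : ℂ)) 1 t := Complex.ofRealCLM.hasDerivAt
    have h2 := ((((h1.const_mul 2).sub_const (x : ℂ)).const_mul (Complex.I * lam)).cexp).div_const
      (2 * (Complex.I * lam))
    refine h2.congr_deriv ?_
    rw [div_eq_iff hc]
    ring
  have hPd : ∀ t : ℝ, HasDerivAt (fun t : ℝ => ((P.eval t : ℝ) : ℂ))
      ((P.derivative.eval t : ℝ) : ℂ) t := fun t => (P.hasDerivAt t).ofReal_comp
  have hFn : ∀ t ∈ Icc 0 x, ‖F t‖ ≤ E / ‖lam‖ := fun t ht => by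
    have hl : 0 < ‖lam‖ := norm_pos_iff.2 hlam
    rw [hF]; dsimp only
    rw [norm_div, norm_mul, norm_mul, Complex.norm_I, one_mul]
    refine div_le_div₀ hE0.le (norm_exp_phase_le lam ht) hl ?_
    simp
    linarith
  have key := integral_mul_deriv_eq_deriv_mul (a := (0 : ℝ)) (b := x)
    (fun t _ => hPd t) (fun t _ => hFd t)
    ((Complex.continuous_ofReal.comp P.derivative.continuous).intervalIntegrable 0 x)
    ((by fun_prop : Continuous fun t : ℝ =>
      Complex.exp (Complex.I * lam * (2 * t - x))).intervalIntegrable 0 x)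
  have e : (∫ t in (0 : ℝ)..x, Complex.exp (Complex.I * lam * (2 * t - x)) * (P.eval t : ℝ))
      = ∫ t in (0 : ℝ)..x, ((P.eval t : ℝ) : ℂ) * Complex.exp (Complex.I * lam * (2 * t - x)) :=
    integral_congr fun t _ => mul_comm _ _
  rw [e, key]
  have hPn : ∀ t ∈ Icc 0 x, ‖((P.eval t : ℝ) : ℂ)‖ ≤ |M| := fun t ht => by
    rw [Complex.norm_real]
    exact (hM t ⟨ht.1, ht.2.trans hx.2⟩).trans (le_abs_self M)
  have hPn' : ∀ t ∈ Icc 0 x, ‖((P.derivative.eval t : ℝ) : ℂ)‖ ≤ |N| := fun t ht => by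
    rw [Complex.norm_real]
    exact (hN t ⟨ht.1, ht.2.trans hx.2⟩).trans (le_abs_self N)
  have b1 : ‖((P.eval x : ℝ) : ℂ) * F x‖ ≤ |M| * (E / ‖lam‖) := by
    rw [norm_mul]
    exact mul_le_mul (hPn x ⟨hx.1, le_rfl⟩) (hFn x ⟨hx.1, le_rfl⟩) (norm_nonneg _) (abs_nonneg _)
  have b2 : ‖((P.eval 0 : ℝ) : ℂ) * F 0‖ ≤ |M| * (E / ‖lam‖) := by
    rw [norm_mul]
    exact mul_le_mul (hPn 0 ⟨le_rfl, hx.1⟩) (hFn 0 ⟨le_rfl, hx.1⟩) (norm_nonneg _) (abs_nonneg _)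
  have b3 : ‖∫ t in (0 : ℝ)..x, ((P.derivative.eval t : ℝ) : ℂ) * F t‖
      ≤ |N| * (E / ‖lam‖) * |x - 0| := norm_integral_le_of_norm_le_const fun t ht => by
    rw [uIoc_of_le hx.1] at ht
    rw [norm_mul]
    exact mul_le_mul (hPn' t ⟨ht.1.le, ht.2⟩) (hFn t ⟨ht.1.le, ht.2⟩) (norm_nonneg _)
      (abs_nonneg _)
  have b4 : |N| * (E / ‖lam‖) * |x - 0| ≤ |N| * (E / ‖lam‖) * |l| := by
    refine mul_le_mul_of_nonneg_left ?_ (by positivity)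
    rw [sub_zero]
    exact abs_le_abs_of_nonneg hx.1 hx.2
  calc _ ≤ ‖((P.eval x : ℝ) : ℂ) * F x‖ + ‖((P.eval 0 : ℝ) : ℂ) * F 0‖
        + ‖∫ t in (0 : ℝ)..x, ((P.derivative.eval t : ℝ) : ℂ) * F t‖ :=
        (norm_sub_le _ _).trans (add_le_add_left (norm_sub_le _ _) _)
    _ ≤ |M| * (E / ‖lam‖) + |M| * (E / ‖lam‖) + |N| * (E / ‖lam‖) * |l| := by linarith
    _ = _ := by ring

/-- A Riemann-Lebesgue lemma for complex frequencies. -/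
theorem riemannLebesgue_complex {q : ℝ → ℝ} {l : ℝ} (hl : 0 ≤ l)
    (hq : ∀ a b : ℝ, IntervalIntegrable q volume a b) {ε : ℝ} (hε : 0 < ε) :
    ∃ R, ∀ lam : ℂ, R ≤ ‖lam‖ → ∀ x ∈ Icc 0 l,
      ‖∫ t in (0 : ℝ)..x, Complex.exp (Complex.I * lam * (2 * t - x)) * (q t : ℂ)‖
        ≤ ε * Real.exp (|lam.im| * x) := by
  obtain ⟨P, hP⟩ := exists_polynomial_integral_abs_sub_le hl (hq 0 l) (half_pos hε)
  obtain ⟨C, hC0, hC⟩ := norm_integral_phase_mul_polynomial_le P l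
  refine ⟨max 1 (C / (ε / 2)), fun lam hlam x hx => ?_⟩
  have hl1 : 1 ≤ ‖lam‖ := (le_max_left _ _).trans hlam
  have hl2 : C / (ε / 2) ≤ ‖lam‖ := (le_max_right _ _).trans hlam
  have hCl : C / ‖lam‖ ≤ ε / 2 := by
    rw [div_le_iff₀ (half_pos hε)] at hl2
    rw [div_le_iff₀ (by linarith)]
    linarith
  have hec : Continuous fun t : ℝ => Complex.exp (Complex.I * lam * (2 * t - x)) := by fun_prop
  have hqi : ∀ a b : ℝ, IntervalIntegrable (fun t => (q t : ℂ)) volume a b := fun a b =>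
    ⟨(hq a b).1.ofReal, (hq a b).2.ofReal⟩
  have hPi : Continuous fun t : ℝ => ((P.eval t : ℝ) : ℂ) :=
    Complex.continuous_ofReal.comp P.continuous
  -- The remainder `q - P` is small in `L¹` for every frequency; the polynomial part is small for
  -- large frequencies.
  have hsub : (∫ t in (0 : ℝ)..x, Complex.exp (Complex.I * lam * (2 * t - x)) * (q t : ℂ))
      = (∫ t in (0 : ℝ)..x, Complex.exp (Complex.I * lam * (2 * t - x)) * ((q t : ℂ) - (P.eval t : ℝ)))
      + ∫ t in (0 : ℝ)..x, Complex.exp (Complex.I * lam * (2 * t - x)) * (P.eval t : ℝ) := by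
    rw [← intervalIntegral.integral_add]
    · exact integral_congr fun t _ => by ring
    · exact ((hqi 0 x).sub (hPi.intervalIntegrable 0 x)).continuousOn_mul hec.continuousOn
    · exact (hec.mul hPi).intervalIntegrable 0 x
  rw [hsub]
  set E := Real.exp (|lam.im| * x) with hE
  have hE0 : 0 < E := Real.exp_pos _
  have habs : ∀ a b : ℝ, IntervalIntegrable (fun t => |q t - P.eval t|) volume a b := fun a b =>
    ((hq a b).sub (P.continuous.intervalIntegrable a b)).abs
  have h1 : ‖∫ t in (0 : ℝ)..x, Complex.exp (Complex.I * lam * (2 * t - x))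
      * ((q t : ℂ) - (P.eval t : ℝ))‖ ≤ ∫ t in (0 : ℝ)..x, E * |q t - P.eval t| := by
    refine intervalIntegral.norm_integral_le_of_norm_le hx.1 (Eventually.of_forall fun t ht => ?_)
      ((habs 0 x).const_mul E)
    rw [norm_mul, ← Complex.ofReal_sub, Complex.norm_real, Real.norm_eq_abs]
    gcongr
    exact norm_exp_phase_le lam ⟨ht.1.le, ht.2⟩
  have h2 : ∫ t in (0 : ℝ)..x, |q t - P.eval t| ≤ ε / 2 :=
    (integral_mono_interval le_rfl hx.1 hx.2 (Eventually.of_forall fun t => abs_nonneg _)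
      (habs 0 l)).trans hP
  rw [intervalIntegral.integral_const_mul] at h1
  have h3 := hC lam (norm_pos_iff.1 (by linarith)) x hx
  calc _ ≤ E * (ε / 2) + ε / 2 * E := (norm_add_le _ _).trans
        (add_le_add (h1.trans (by gcongr)) (h3.trans (by gcongr)))
    _ = ε * E := by ring

theorem riemannLebesgue_cos_sin {q : ℝ → ℝ} {l : ℝ} (hl : 0 ≤ l)
    (hq : ∀ a b : ℝ, IntervalIntegrable q volume a b) {ε : ℝ} (hε : 0 < ε) :
    ∃ R, ∀ lam : ℂ, R ≤ ‖lam‖ → ∀ x ∈ Icc 0 l,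
      ‖∫ t in (0 : ℝ)..x, Complex.cos (lam * (2 * t - x)) * (q t : ℂ)‖
        ≤ ε * Real.exp (|lam.im| * x) ∧
      ‖∫ t in (0 : ℝ)..x, Complex.sin (lam * (2 * t - x)) * (q t : ℂ)‖
        ≤ ε * Real.exp (|lam.im| * x) := by
  obtain ⟨R, hR⟩ := riemannLebesgue_complex hl hq hε
  refine ⟨R, fun lam hlam x hx => ?_⟩
  have h1 := hR lam hlam x hx
  have h2 := hR (-lam) (by rwa [norm_neg]) x hx
  rw [Complex.neg_im, abs_neg] at h2
  have hqi : IntervalIntegrable (fun t => (q t : ℂ)) volume 0 x :=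
    ⟨(hq 0 x).1.ofReal, (hq 0 x).2.ofReal⟩
  have hi : ∀ mu : ℂ, IntervalIntegrable
      (fun t : ℝ => Complex.exp (Complex.I * mu * (2 * t - x)) * (q t : ℂ)) volume 0 x := fun mu =>
    hqi.continuousOn_mul (by fun_prop : Continuous fun t : ℝ =>
      Complex.exp (Complex.I * mu * (2 * t - x))).continuousOn
  set A := ∫ t in (0 : ℝ)..x, Complex.exp (Complex.I * lam * (2 * t - x)) * (q t : ℂ)
  set B := ∫ t in (0 : ℝ)..x, Complex.exp (Complex.I * -lam * (2 * t - x)) * (q t : ℂ)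
  have hc : (∫ t in (0 : ℝ)..x, Complex.cos (lam * (2 * t - x)) * (q t : ℂ)) = (A + B) / 2 := by
    rw [← integral_add (hi _) (hi _), ← intervalIntegral.integral_div]
    refine integral_congr fun t _ => ?_
    simp only [Complex.cos]
    rw [show lam * (2 * t - x) * Complex.I = Complex.I * lam * (2 * t - x) by ring,
      show -(lam * (2 * t - x)) * Complex.I = Complex.I * -lam * (2 * t - x) by ring]
    ring
  have hs : (∫ t in (0 : ℝ)..x, Complex.sin (lam * (2 * t - x)) * (q t : ℂ))
      = (B - A) * Complex.I / 2 := by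
    rw [← integral_sub (hi _) (hi _), ← intervalIntegral.integral_mul_const,
      ← intervalIntegral.integral_div]
    refine integral_congr fun t _ => ?_
    simp only [Complex.sin]
    rw [show lam * (2 * t - x) * Complex.I = Complex.I * lam * (2 * t - x) by ring,
      show -(lam * (2 * t - x)) * Complex.I = Complex.I * -lam * (2 * t - x) by ring]
    ring
  rw [hc, hs]
  constructor
  · rw [norm_div, Complex.norm_ofNat]
    linarith [norm_add_le A B]
  · rw [norm_div, norm_mul, Complex.norm_I, Complex.norm_ofNat]
    linarith [norm_sub_le B A]

end RiemannLebesgue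

end SelfAdjointSystem

namespace SelfAdjointSystem

attribute [local instance] Matrix.linftyOpNormedRing Matrix.linftyOpNormedAlgebra
attribute [local instance] normTopology normedAlgebraReal normedSpaceReal

/-! ### The free solution -/

section Rotation

/-- The matrix `exp (z J)`. -/
noncomputable def rot (z : ℂ) : M2 :=
  !![Complex.cos z, Complex.sin z; -Complex.sin z, Complex.cos z]

@[simp] theorem rot_zero : rot 0 = 1 := by
  ext i j
  fin_cases i <;> fin_cases j <;> simp [rot]

theorem rot_add (a b : ℂ) : rot (a + b) = rot a * rot b := by
  ext i j
  fin_cases i <;> fin_cases j <;>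
    simp [rot, Matrix.mul_apply, Fin.sum_univ_two, Complex.cos_add, Complex.sin_add] <;> ring

theorem rot_neg_mul (a : ℂ) : rot (-a) * rot a = 1 := by rw [← rot_add]; simp

theorem J_mul_rot (z : ℂ) : J * rot z = rot z * J := by
  ext i j
  fin_cases i <;> fin_cases j <;> simp [rot, J, Matrix.mul_apply, Fin.sum_univ_two]

theorem norm_cos_le (z : ℂ) : ‖Complex.cos z‖ ≤ Real.exp |z.im| := by
  have h1 : ‖Complex.exp (z * Complex.I)‖ ≤ Real.exp |z.im| := by
    rw [Complex.norm_exp, Real.exp_le_exp]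
    simpa using neg_le_abs z.im
  have h2 : ‖Complex.exp (-z * Complex.I)‖ ≤ Real.exp |z.im| := by
    rw [Complex.norm_exp, Real.exp_le_exp]
    simpa using le_abs_self z.im
  rw [Complex.cos, norm_div, Complex.norm_ofNat]
  linarith [norm_add_le (Complex.exp (z * Complex.I)) (Complex.exp (-z * Complex.I))]

theorem norm_sin_le (z : ℂ) : ‖Complex.sin z‖ ≤ Real.exp |z.im| := by
  have h := norm_cos_le (z - Real.pi / 2)
  rw [Complex.cos_sub_pi_div_two] at h
  simpa using h

theorem norm_rot_le (z : ℂ) : ‖rot z‖ ≤ 2 * Real.exp |z.im| := by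
  refine norm_le_of_row_sums_le fun i => ?_
  have h1 := norm_cos_le z
  have h2 := norm_sin_le z
  fin_cases i <;> simp [rot] <;> linarith

theorem rot_hasDerivAt_entry (lam : ℂ) (t : ℝ) (i j : Fin 2) :
    HasDerivAt (fun t : ℝ => rot (lam * t) i j) ((lam • (J * rot (lam * t))) i j) t := by
  have h1 : HasDerivAt (fun t : ℝ => lam * t) lam t := by
    simpa using (Complex.ofRealCLM.hasDerivAt (x := t)).const_mul lam
  have hc := (Complex.hasDerivAt_cos _).comp t h1
  have hs := (Complex.hasDerivAt_sin _).comp t h1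
  fin_cases i <;> fin_cases j
  · refine hc.congr_deriv ?_
    simp [rot, J]; ring
  · refine hs.congr_deriv ?_
    simp [rot, J]; ring
  · refine hs.neg.congr_deriv ?_
    simp [rot, J]; ring
  · refine hc.congr_deriv ?_
    simp [rot, J]; ring

theorem continuous_rot_entry (i j : Fin 2) : Continuous fun z => rot z i j := by
  fin_cases i <;> fin_cases j <;> simp [rot] <;> fun_prop

theorem rot_isIntegralOf (lam : ℂ) :
    IsIntegralOf (fun t : ℝ => rot (lam * t)) fun t => lam • (J * rot (lam * t)) := by
  refine isIntegralOf_matrix fun i j =>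
    .of_hasDerivAt (fun t => rot_hasDerivAt_entry lam t i j) ?_
  have hl : Continuous fun t : ℝ => lam * (t : ℂ) := by fun_prop
  have hent : ∀ i j, Continuous fun t : ℝ => rot (lam * t) i j := fun i j =>
    (continuous_rot_entry i j).comp hl
  simp only [J_mul_eq]
  fin_cases i <;> fin_cases j
  · exact continuous_const.mul (hent 1 0)
  · exact continuous_const.mul (hent 1 1)
  · exact continuous_const.mul (hent 0 0).neg
  · exact continuous_const.mul (hent 0 1).neg

theorem continuous_rot : Continuous rot := by
  have : rot = fun z => Complex.cos z • (1 : M2) + Complex.sin z • J := by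
    ext z i j
    fin_cases i <;> fin_cases j <;> simp [rot, J]
  rw [this]
  exact (Complex.continuous_cos.smul continuous_const).add
    (Complex.continuous_sin.smul continuous_const)

end Rotation

/-! ### High energy asymptotics of the fundamental solution -/

namespace DiracPotential

variable (V : DiracPotential)

theorem mat_mul_rot (t : ℝ) (z : ℂ) : V.mat t * rot z = rot (-z) * V.mat t := by
  ext i j
  fin_cases i <;> fin_cases j <;>
    simp [rot, mat, Matrix.mul_apply, Fin.sum_univ_two] <;> ring

theorem J_mul_rot_mul_mat (z : ℂ) (t : ℝ) : J * (rot z * V.mat t) =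
    !![Complex.cos z * V.r t - Complex.sin z * V.p t,
        -(Complex.cos z * V.p t + Complex.sin z * V.r t);
      -(Complex.cos z * V.p t + Complex.sin z * V.r t),
        Complex.sin z * V.p t - Complex.cos z * V.r t] := by
  rw [J_mul_eq]
  ext i j
  fin_cases i <;> fin_cases j <;> simp [rot, mat, Matrix.mul_apply, Fin.sum_univ_two] <;> ring

theorem p_ofReal_intervalIntegrable (a b : ℝ) :
    IntervalIntegrable (fun t => (V.p t : ℂ)) volume a b :=
  ⟨(V.p_int a b).1.ofReal, (V.p_int a b).2.ofReal⟩

theorem r_ofReal_intervalIntegrable (a b : ℝ) :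
    IntervalIntegrable (fun t => (V.r t : ℂ)) volume a b :=
  ⟨(V.r_int a b).1.ofReal, (V.r_int a b).2.ofReal⟩

theorem mat_intervalIntegrable (a b : ℝ) : IntervalIntegrable V.mat volume a b := by
  refine intervalIntegrable_matrix (fun i j a b => ?_) a b
  fin_cases i <;> fin_cases j
  · exact V.p_ofReal_intervalIntegrable a b
  · exact V.r_ofReal_intervalIntegrable a b
  · exact V.r_ofReal_intervalIntegrable a b
  · exact (V.p_ofReal_intervalIntegrable a b).neg

theorem norm_J_mul_mat_le (t : ℝ) : ‖J * V.mat t‖ ≤ |V.p t| + |V.r t| := by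
  have := V.norm_coef_le 0 t
  simpa [coef] using this

/-- Variation of constants around the free solution. -/
theorem fund_eq_rot_mul (lam : ℂ) (x : ℝ) : V.fund lam x = rot (-(lam * x)) *
    (1 + ∫ t in (0 : ℝ)..x, rot (lam * t) * (J * V.mat t) * V.fund lam t) := by
  have h := (rot_isIntegralOf lam).mul (V.fund_isIntegralOf lam)
  have e : ∀ t : ℝ, lam • (J * rot (lam * t)) * V.fund lam t
      + rot (lam * t) * (V.coef lam t * V.fund lam t)
      = rot (lam * t) * (J * V.mat t) * V.fund lam t := fun t => by
    rw [coef, mul_sub, J_mul_rot, mul_smul_comm, mul_one]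
    simp only [sub_mul, mul_sub, smul_mul_assoc, mul_smul_comm, mul_assoc]
    abel
  simp only [e] at h
  have h2 := h.eq_add x
  simp only [Complex.ofReal_zero, mul_zero, rot_zero, one_mul, fund_zero] at h2
  rw [← h2, ← mul_assoc, rot_neg_mul, one_mul]

/-- The potential reverses rotations, `V rot(z) = rot(-z) V`, so in the first order term the free
phases `lam (t - x)` and `-lam t` combine to `lam (2 t - x)`. This term oscillates and is small by
the Riemann-Lebesgue lemma; the second is left to Gronwall. -/
theorem fund_sub_rot_eq (lam : ℂ) (x : ℝ) : V.fund lam x - rot (-(lam * x)) =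
    (∫ t in (0 : ℝ)..x, J * (rot (lam * (2 * t - x)) * V.mat t)) +
    ∫ t in (0 : ℝ)..x, rot (lam * (t - x)) * (J * V.mat t) *
      (V.fund lam t - rot (-(lam * t))) := by
  have hm := fun a b => V.mat_intervalIntegrable a b
  have hr1 : Continuous fun t : ℝ => rot (lam * (2 * t - x)) := continuous_rot.comp (by fun_prop)
  have hr2 : Continuous fun t : ℝ => rot (lam * (t - x)) := continuous_rot.comp (by fun_prop)
  have hr3 : Continuous fun t : ℝ => rot (-(lam * t)) := continuous_rot.comp (by fun_prop)
  have hr4 : Continuous fun t : ℝ => rot (lam * t) := continuous_rot.comp (by fun_prop)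
  have i1 : IntervalIntegrable (fun t : ℝ => J * (rot (lam * (2 * t - x)) * V.mat t)) volume 0 x :=
    ((hm 0 x).continuousOn_mul hr1.continuousOn).continuousOn_mul continuousOn_const
  have i2 : IntervalIntegrable (fun t : ℝ => rot (lam * (t - x)) * (J * V.mat t) *
      (V.fund lam t - rot (-(lam * t)))) volume 0 x :=
    ((((hm 0 x).continuousOn_mul continuousOn_const).continuousOn_mul
      hr2.continuousOn).mul_continuousOn ((V.fund_continuous lam).sub hr3).continuousOn)
  have i3 : IntervalIntegrable (fun t : ℝ => rot (lam * t) * (J * V.mat t) * V.fund lam t)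
      volume 0 x :=
    ((((hm 0 x).continuousOn_mul continuousOn_const).continuousOn_mul
      hr4.continuousOn).mul_continuousOn (V.fund_continuous lam).continuousOn)
  rw [← intervalIntegral.integral_add i1 i2]
  have h := V.fund_eq_rot_mul lam x
  rw [mul_add, mul_one] at h
  rw [sub_eq_of_eq_add' h]
  have hcomm := ((ContinuousLinearMap.mul ℝ M2 (rot (-(lam * x)))).intervalIntegral_comp_comm i3)
  simp only [ContinuousLinearMap.mul_apply'] at hcomm
  rw [← hcomm]
  refine integral_congr fun t _ => ?_
  have a1 : rot (lam * (t - x)) = rot (-(lam * x)) * rot (lam * t) := by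
    rw [← rot_add]; congr 1; ring
  have a2 : J * (rot (lam * (2 * t - x)) * V.mat t)
      = rot (lam * (t - x)) * (J * V.mat t) * rot (-(lam * t)) := by
    have a3 : rot (lam * (2 * t - x)) = rot (lam * (t - x)) * rot (lam * t) := by
      rw [← rot_add]; congr 1; ring
    have a4 : rot (lam * t) * V.mat t = V.mat t * rot (-(lam * t)) := by
      rw [mat_mul_rot, neg_neg]
    rw [a3, mul_assoc (rot _), ← mul_assoc J, J_mul_rot, a4]
    simp only [mul_assoc]
  rw [a2, ← mul_add, add_sub_cancel, a1]
  simp only [mul_assoc]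

theorem norm_integral_rot_mul_mat_le {l : ℝ} (hl : 0 ≤ l) {ε : ℝ} (hε : 0 < ε) :
    ∃ R, ∀ lam : ℂ, R ≤ ‖lam‖ → ∀ x ∈ Icc 0 l,
      ‖∫ t in (0 : ℝ)..x, J * (rot (lam * (2 * t - x)) * V.mat t)‖
        ≤ ε * Real.exp (|lam.im| * x) := by
  obtain ⟨R₁, h₁⟩ := riemannLebesgue_cos_sin hl V.p_int (by positivity : 0 < ε / 4)
  obtain ⟨R₂, h₂⟩ := riemannLebesgue_cos_sin hl V.r_int (by positivity : 0 < ε / 4)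
  refine ⟨max R₁ R₂, fun lam hlam x hx => ?_⟩
  obtain ⟨cp, sp⟩ := h₁ lam ((le_max_left _ _).trans hlam) x hx
  obtain ⟨cr, sr⟩ := h₂ lam ((le_max_right _ _).trans hlam) x hx
  have hc : Continuous fun t : ℝ => Complex.cos (lam * (2 * t - x)) := by fun_prop
  have hs : Continuous fun t : ℝ => Complex.sin (lam * (2 * t - x)) := by fun_prop
  have icp := (V.p_ofReal_intervalIntegrable 0 x).continuousOn_mul hc.continuousOn
  have isp := (V.p_ofReal_intervalIntegrable 0 x).continuousOn_mul hs.continuousOn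
  have icr := (V.r_ofReal_intervalIntegrable 0 x).continuousOn_mul hc.continuousOn
  have isr := (V.r_ofReal_intervalIntegrable 0 x).continuousOn_mul hs.continuousOn
  have hr1 : Continuous fun t : ℝ => rot (lam * (2 * t - x)) := continuous_rot.comp (by fun_prop)
  have i1 : IntervalIntegrable (fun t : ℝ => J * (rot (lam * (2 * t - x)) * V.mat t)) volume 0 x :=
    ((V.mat_intervalIntegrable 0 x).continuousOn_mul hr1.continuousOn).continuousOn_mul
      continuousOn_const
  set E := Real.exp (|lam.im| * x)
  have hent : ∀ i j, (∫ t in (0 : ℝ)..x, J * (rot (lam * (2 * t - x)) * V.mat t)) i j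
      = ∫ t in (0 : ℝ)..x, (J * (rot (lam * (2 * t - x)) * V.mat t)) i j := fun i j =>
    ((entryCLM i j).intervalIntegral_comp_comm i1).symm
  have e00 : ‖∫ t in (0 : ℝ)..x, (J * (rot (lam * (2 * t - x)) * V.mat t)) 0 0‖
      ≤ ε / 4 * E + ε / 4 * E := by
    refine le_trans (le_of_eq ?_) ((norm_sub_le _ _).trans (add_le_add cr sp))
    rw [← integral_sub icr isp]
    congr 1
    refine integral_congr fun t _ => ?_
    simp [J_mul_rot_mul_mat]
  have e01 : ‖∫ t in (0 : ℝ)..x, (J * (rot (lam * (2 * t - x)) * V.mat t)) 0 1‖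
      ≤ ε / 4 * E + ε / 4 * E := by
    refine le_trans (le_of_eq ?_) ((norm_add_le _ _).trans (add_le_add cp sr))
    rw [← intervalIntegral.integral_add icp isr, ← norm_neg, ← intervalIntegral.integral_neg]
    congr 1
    refine integral_congr fun t _ => ?_
    simp [J_mul_rot_mul_mat]
  have e10 : ‖∫ t in (0 : ℝ)..x, (J * (rot (lam * (2 * t - x)) * V.mat t)) 1 0‖
      ≤ ε / 4 * E + ε / 4 * E := by
    refine le_trans (le_of_eq ?_) ((norm_add_le _ _).trans (add_le_add cp sr))
    rw [← intervalIntegral.integral_add icp isr, ← norm_neg, ← intervalIntegral.integral_neg]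
    congr 1
    refine integral_congr fun t _ => ?_
    simp [J_mul_rot_mul_mat]
  have e11 : ‖∫ t in (0 : ℝ)..x, (J * (rot (lam * (2 * t - x)) * V.mat t)) 1 1‖
      ≤ ε / 4 * E + ε / 4 * E := by
    refine le_trans (le_of_eq ?_) ((norm_sub_le _ _).trans (add_le_add sp cr))
    rw [← integral_sub isp icr]
    congr 1
    refine integral_congr fun t _ => ?_
    simp [J_mul_rot_mul_mat]
  refine norm_le_of_row_sums_le fun i => ?_
  rw [hent, hent]
  fin_cases i
  · exact (add_le_add e00 e01).trans (by linarith)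
  · exact (add_le_add e10 e11).trans (by linarith)

/-- High energy asymptotics of the fundamental solution. -/
theorem norm_fund_sub_rot_le {l : ℝ} (hl : 0 ≤ l) {ε : ℝ} (hε : 0 < ε) :
    ∃ R, ∀ lam : ℂ, R ≤ ‖lam‖ →
      ‖V.fund lam l - rot (-(lam * l))‖ ≤ ε * Real.exp (|lam.im| * l) := by
  set a : ℝ → ℝ := fun t => 2 * (|V.p t| + |V.r t|) with ha
  have hai : ∀ s t : ℝ, IntervalIntegrable a volume s t := fun s t =>
    (((V.p_int s t).abs).add (V.r_int s t).abs).const_mul 2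
  set K := Real.exp (∫ t in (0 : ℝ)..l, a t) with hK
  have hK0 : 0 < K := Real.exp_pos _
  obtain ⟨R, hR⟩ := V.norm_integral_rot_mul_mat_le hl (div_pos hε hK0)
  refine ⟨R, fun lam hlam => ?_⟩
  -- After weighting with `exp(-k x)` the kernel `rot (lam (t - x))` is bounded by `2`, which
  -- explains the factor in `a`. Gronwall then costs the constant `K`, prepared for by starting from
  -- `ε / K`.
  set k := |lam.im|
  have hr3 : Continuous fun t : ℝ => rot (-(lam * t)) := continuous_rot.comp (by fun_prop)
  have hwc : Continuous fun t : ℝ => V.fund lam t - rot (-(lam * t)) :=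
    (V.fund_continuous lam).sub hr3
  have hexp : Continuous fun x : ℝ => Real.exp (-(k * x)) := by fun_prop
  have key := le_mul_exp_of_le_add_integral (a := a) (ε := ε / K) (l := l)
    (w := fun x => Real.exp (-(k * x)) * ‖V.fund lam x - rot (-(lam * x))‖) hai
    (fun t => by positivity) (hexp.mul hwc.norm) (by positivity) (fun x hx => ?_) l ⟨hl, le_rfl⟩
  · rw [div_mul_cancel₀ _ hK0.ne', Real.exp_neg, inv_mul_le_iff₀ (Real.exp_pos _)] at key
    linarith
  · rw [V.fund_sub_rot_eq lam x]
    have hE : Real.exp (-(k * x)) * Real.exp (k * x) = 1 := by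
      rw [← Real.exp_add]; simp
    have b1 : Real.exp (-(k * x)) *
        ‖∫ t in (0 : ℝ)..x, J * (rot (lam * (2 * t - x)) * V.mat t)‖ ≤ ε / K := by
      refine (mul_le_mul_of_nonneg_left (hR lam hlam x hx) (Real.exp_pos _).le).trans (le_of_eq ?_)
      rw [mul_left_comm, hE, mul_one]
    have b2 : ‖∫ t in (0 : ℝ)..x, rot (lam * (t - x)) * (J * V.mat t) *
        (V.fund lam t - rot (-(lam * t)))‖ ≤ ∫ t in (0 : ℝ)..x, Real.exp (k * x) *
        (a t * (Real.exp (-(k * t)) * ‖V.fund lam t - rot (-(lam * t))‖)) := by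
      refine intervalIntegral.norm_integral_le_of_norm_le hx.1 (Eventually.of_forall fun t ht => ?_)
        (((hai 0 x).mul_continuousOn (hexp.mul hwc.norm).continuousOn).const_mul _)
      have c1 : ‖rot (lam * (t - x))‖ ≤ 2 * (Real.exp (k * x) * Real.exp (-(k * t))) := by
        refine (norm_rot_le _).trans (le_of_eq ?_)
        rw [← Real.exp_add, ← Complex.ofReal_sub, Complex.im_mul_ofReal, abs_mul,
          abs_of_nonpos (by linarith [ht.2] : t - x ≤ 0)]
        congr 2
        ring
      calc _ ≤ ‖rot (lam * (t - x))‖ * ‖J * V.mat t‖ * ‖V.fund lam t - rot (-(lam * t))‖ :=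
            (norm_mul_le _ _).trans
              (mul_le_mul_of_nonneg_right (norm_mul_le _ _) (norm_nonneg _))
        _ ≤ 2 * (Real.exp (k * x) * Real.exp (-(k * t))) * (|V.p t| + |V.r t|)
            * ‖V.fund lam t - rot (-(lam * t))‖ := by
            gcongr
            exact V.norm_J_mul_mat_le t
        _ = _ := by rw [ha]; ring
    rw [intervalIntegral.integral_const_mul] at b2
    calc _ ≤ Real.exp (-(k * x)) * (‖∫ t in (0 : ℝ)..x, J * (rot (lam * (2 * t - x)) * V.mat t)‖
          + ‖∫ t in (0 : ℝ)..x, rot (lam * (t - x)) * (J * V.mat t) *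
        (V.fund lam t - rot (-(lam * t)))‖) := by
          gcongr
          exact norm_add_le _ _
      _ ≤ ε / K + Real.exp (-(k * x)) * (Real.exp (k * x) * ∫ t in (0 : ℝ)..x,
        (a t * (Real.exp (-(k * t)) * ‖V.fund lam t - rot (-(lam * t))‖))) := by
          rw [mul_add]
          gcongr
      _ = _ := by rw [← mul_assoc, hE, one_mul]

end DiracPotential

end SelfAdjointSystem

namespace SelfAdjointSystem

/-! ### Division and growth of entire functions -/

section EntireFunctions

/-- Division of entire functions when the zeros of the divisor are matched in order. -/
theorem exists_differentiable_mul_eq {f g : ℂ → ℂ} (hf : Differentiable ℂ f)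
    (hg : Differentiable ℂ g)
    (h : ∀ z, g z = 0 → ∃ k : ℕ, analyticOrderAt g z = k ∧ (k : ℕ∞) ≤ analyticOrderAt f z) :
    ∃ F : ℂ → ℂ, Differentiable ℂ F ∧ ∀ z, F z * g z = f z := by
  have hloc : ∀ z, ∃ q : ℂ → ℂ, AnalyticAt ℂ q z ∧ (∀ᶠ w in 𝓝[≠] z, (f / g) w = q w ∧ g w ≠ 0) := by
    intro z
    by_cases hz : g z = 0
    · obtain ⟨k, hgk, hfk⟩ := h z hz
      obtain ⟨u, hu, hu0, hgu⟩ := ((hg.analyticAt z).analyticOrderAt_eq_natCast).1 hgk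
      obtain ⟨v, hv, hfv⟩ := (natCast_le_analyticOrderAt (hf.analyticAt z)).1 hfk
      refine ⟨fun w => v w / u w, hv.div hu hu0, ?_⟩
      filter_upwards [nhdsWithin_le_nhds hgu, nhdsWithin_le_nhds hfv,
        nhdsWithin_le_nhds (hu.continuousAt.eventually_ne hu0), self_mem_nhdsWithin]
        with w h1 h2 h3 h4
      have h5 : (w - z) ^ k ≠ 0 := pow_ne_zero _ (sub_ne_zero.2 h4)
      refine ⟨?_, by rw [h1]; exact smul_ne_zero h5 h3⟩
      rw [Pi.div_apply, h1, h2, smul_eq_mul, smul_eq_mul, mul_div_mul_left _ _ h5]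
    · refine ⟨f / g, (hf.analyticAt z).div (hg.analyticAt z) hz, ?_⟩
      filter_upwards [nhdsWithin_le_nhds (hg.continuous.continuousAt.eventually_ne hz)] with w hw
        using ⟨rfl, hw⟩
  -- Passing to the meromorphic normal form fills in the removable singularities of `f / g`; the
  -- product identity then extends over the zeros of `g` by continuity.
  have hm : MeromorphicOn (f / g) univ := fun z _ =>
    (hf.analyticAt z).meromorphicAt.div (hg.analyticAt z).meromorphicAt
  have hF : ∀ z, AnalyticAt ℂ (toMeromorphicNFOn (f / g) univ) z := fun z => by
    rw [← (meromorphicNFOn_toMeromorphicNFOn (f / g) univ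
      (mem_univ z)).meromorphicOrderAt_nonneg_iff_analyticAt,
      meromorphicOrderAt_toMeromorphicNFOn hm (mem_univ z)]
    obtain ⟨q, hq, hfq⟩ := hloc z
    rw [meromorphicOrderAt_congr (hfq.mono fun w hw => hw.1)]
    exact hq.meromorphicOrderAt_nonneg
  refine ⟨toMeromorphicNFOn (f / g) univ, fun z => (hF z).differentiableAt, fun z => ?_⟩
  obtain ⟨q, -, hfq⟩ := hloc z
  have hev : (fun w => toMeromorphicNFOn (f / g) univ w * g w) =ᶠ[𝓝[≠] z] f := by
    filter_upwards [hm.toMeromorphicNFOn_eq_self_on_nhdsNE (mem_univ z), hfq] with w h1 h2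
    rw [h1, Pi.div_apply, div_mul_cancel₀ _ h2.2]
  have t1 : Tendsto (fun w => toMeromorphicNFOn (f / g) univ w * g w) (𝓝[≠] z)
      (𝓝 (toMeromorphicNFOn (f / g) univ z * g z)) :=
    ((hF z).continuousAt.mul hg.continuous.continuousAt).tendsto.mono_left nhdsWithin_le_nhds
  have t2 : Tendsto f (𝓝[≠] z) (𝓝 (f z)) :=
    hf.continuous.continuousAt.tendsto.mono_left nhdsWithin_le_nhds
  exact tendsto_nhds_unique (t1.congr' hev) t2

theorem normSq_sin (z : ℂ) :
    Complex.normSq (Complex.sin z) = Real.cosh z.im ^ 2 - Real.cos z.re ^ 2 := by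
  have h : Complex.sin z = ((Real.sin z.re * Real.cosh z.im : ℝ) : ℂ)
      + ((Real.cos z.re * Real.sinh z.im : ℝ) : ℂ) * Complex.I := by
    rw [Complex.sin_eq]; push_cast; ring
  rw [h, Complex.normSq_add_mul_I]
  have h1 := Real.sin_sq_add_cos_sq z.re
  have h2 := Real.cosh_sq z.im
  rw [mul_pow, mul_pow, show Real.sin z.re ^ 2 = 1 - Real.cos z.re ^ 2 by linarith, h2]
  ring

/-- Either `|Re lam|` is within `1/2` of the odd number `2 k + 1`, and then `cos² ≤ 1/2`; or the
circle forces `(Im lam)² ≥ 3/4`, and then `cosh² ≥ 2`. By `|sin|² = cosh² - cos²` this keeps the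
sine away from zero on the circle. -/
theorem cos_sq_le_of_norm_eq_odd {lam : ℂ} {k : ℕ} (h : ‖lam‖ = 2 * k + 1) :
    Real.cos (lam.re * (Real.pi / 2)) ^ 2 ≤ Real.cosh (lam.im * (Real.pi / 2)) ^ 2 / 2 := by
  have hc := Real.one_le_cosh (lam.im * (Real.pi / 2))
  have hre : |lam.re| ≤ 2 * k + 1 := h ▸ Complex.abs_re_le_norm lam
  have hk : (0 : ℝ) ≤ k := k.cast_nonneg
  by_cases hcase : 2 * (k : ℝ) + 1 / 2 ≤ |lam.re|
  · have hcos : Real.cos (lam.re * (Real.pi / 2)) ^ 2 ≤ 1 / 2 := by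
      have e1 : Real.cos (lam.re * (Real.pi / 2)) = Real.cos (|lam.re| * (Real.pi / 2)) := by
        rw [← Real.cos_abs, abs_mul, abs_of_pos (by positivity : 0 < Real.pi / 2)]
      have e2 : 2 * (|lam.re| * (Real.pi / 2))
          = ((2 * k + 1 - |lam.re|) * -Real.pi + Real.pi) + k * (2 * Real.pi) := by ring
      have e3 : 0 ≤ Real.cos ((2 * k + 1 - |lam.re|) * -Real.pi) := by
        apply Real.cos_nonneg_of_mem_Icc
        constructor <;> nlinarith [Real.pi_pos]
      rw [e1, Real.cos_sq, e2, Real.cos_add_nat_mul_two_pi, Real.cos_add_pi]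
      linarith
    nlinarith
  · push Not at hcase
    have h1 : 3 / 4 ≤ lam.im ^ 2 := by
      have h2 : lam.re ^ 2 + lam.im ^ 2 = (2 * k + 1) ^ 2 := by
        rw [← h, ← Complex.normSq_eq_norm_sq, Complex.normSq_apply]; ring
      have h3 : lam.re ^ 2 ≤ (2 * k + 1 / 2) ^ 2 := by
        rw [← sq_abs lam.re]
        exact pow_le_pow_left₀ (abs_nonneg _) hcase.le 2
      nlinarith
    have h4 : (lam.im * (Real.pi / 2)) ^ 2 ≤ Real.sinh (lam.im * (Real.pi / 2)) ^ 2 := by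
      rw [← sq_abs, ← sq_abs (Real.sinh _), Real.abs_sinh]
      exact pow_le_pow_left₀ (abs_nonneg _) (Real.self_le_sinh_iff.2 (abs_nonneg _)) 2
    have h5 : 1 ≤ (lam.im * (Real.pi / 2)) ^ 2 := by
      have h6 : (9 : ℝ) / 4 ≤ (Real.pi / 2) ^ 2 := by nlinarith [Real.pi_gt_three]
      rw [mul_pow]
      nlinarith
    have h7 := Real.cosh_sq (lam.im * (Real.pi / 2))
    have h8 := Real.cos_sq_le_one (lam.re * (Real.pi / 2))
    linarith

/-- Lower bound for the free discriminant on circles of odd radius. -/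
theorem exp_le_norm_two_sub_two_mul_cos {lam : ℂ} {k : ℕ} (h : ‖lam‖ = 2 * k + 1) :
    Real.exp (|lam.im| * Real.pi) / 2 ≤ ‖2 - 2 * Complex.cos (lam * Real.pi)‖ := by
  have e1 : 2 - 2 * Complex.cos (lam * Real.pi)
      = 4 * Complex.sin (lam * ((Real.pi / 2 : ℝ) : ℂ)) ^ 2 := by
    have : lam * Real.pi = 2 * (lam * ((Real.pi / 2 : ℝ) : ℂ)) := by push_cast; ring
    rw [this, Complex.cos_two_mul, Complex.sin_sq]
    ring
  have e2 : Real.exp (|lam.im| * Real.pi) ≤ 4 * Real.cosh (lam.im * (Real.pi / 2)) ^ 2 := by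
    rw [← Real.cosh_abs, abs_mul, abs_of_pos (by positivity : 0 < Real.pi / 2)]
    have : Real.exp (|lam.im| * Real.pi) = Real.exp (|lam.im| * (Real.pi / 2)) ^ 2 := by
      rw [← Real.exp_nat_mul]; congr 1; push_cast; ring
    rw [this, show 4 * Real.cosh (|lam.im| * (Real.pi / 2)) ^ 2
      = (2 * Real.cosh (|lam.im| * (Real.pi / 2))) ^ 2 by ring]
    refine pow_le_pow_left₀ (Real.exp_pos _).le ?_ 2
    rw [Real.cosh_eq]
    linarith [Real.exp_pos (-(|lam.im| * (Real.pi / 2)))]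
  rw [e1, norm_mul, norm_pow, ← Complex.normSq_eq_norm_sq, normSq_sin, Complex.norm_ofNat,
    Complex.im_mul_ofReal, Complex.re_mul_ofReal]
  linarith [cos_sq_le_of_norm_eq_odd h]

/-- A Hochstadt type uniqueness principle: an entire function vanishing at all (double) zeros of
`D - 2` and of smaller growth than the square root of `D - 2` vanishes identically. -/
theorem eq_zero_of_onlyDoubleZeros {n D : ℂ → ℂ} (hn : Differentiable ℂ n)
    (hD : Differentiable ℂ D) (hdouble : OnlyDoubleZeros fun lam => D lam - 2)
    (hzero : ∀ lam, D lam = 2 → n lam = 0)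
    (hng : ∀ ε > 0, ∃ R : ℝ, ∀ lam : ℂ, R ≤ ‖lam‖ →
      ‖n lam‖ ≤ ε * Real.exp (|lam.im| * (Real.pi / 2)))
    (hDg : ∃ R : ℝ, ∀ lam : ℂ, ∀ k : ℕ, ‖lam‖ = 2 * k + 1 → R ≤ ‖lam‖ →
      Real.exp (|lam.im| * Real.pi) / 4 ≤ ‖D lam - 2‖) (lam : ℂ) : n lam = 0 := by
  obtain ⟨F, hF, hFe⟩ := exists_differentiable_mul_eq (hn.pow 2) (hD.sub_const 2) fun z hz => by
    refine ⟨2, hdouble z hz, ?_⟩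
    have han := hn.analyticAt z
    have h1 : 1 ≤ analyticOrderAt n z := by
      rw [Order.one_le_iff_ne_zero, han.analyticOrderAt_ne_zero]
      exact hzero z (sub_eq_zero.1 hz)
    rw [analyticOrderAt_pow han]
    calc ((2 : ℕ) : ℕ∞) = 2 • 1 := by simp
      _ ≤ 2 • analyticOrderAt n z := nsmul_le_nsmul_right h1 2
  -- Here `F = n² / (D - 2)`. The maximum principle on a disc of large odd radius transfers the
  -- boundary estimate, in which both exponentials cancel.
  have hbound : ∀ ε > 0, ‖F lam‖ ≤ 4 * ε ^ 2 := fun ε hε => by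
    obtain ⟨R₁, h₁⟩ := hng ε hε
    obtain ⟨R₂, h₂⟩ := hDg
    obtain ⟨k, hk⟩ := exists_nat_ge (max (max R₁ R₂) ‖lam‖)
    have hk1 : R₁ ≤ k := ((le_max_left _ _).trans (le_max_left _ _)).trans hk
    have hk2 : R₂ ≤ k := ((le_max_right _ _).trans (le_max_left _ _)).trans hk
    have hk3 : ‖lam‖ ≤ k := (le_max_right _ _).trans hk
    have hk0 : (0 : ℝ) ≤ k := k.cast_nonneg
    refine Complex.norm_le_of_forall_mem_frontier_norm_le
      (Metric.isBounded_ball (x := (0 : ℂ)) (r := 2 * k + 1)) hF.diffContOnCl (fun z hz => ?_)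
      (subset_closure (by rw [Metric.mem_ball, dist_zero_right]; linarith))
    rw [frontier_ball _ (by positivity : (2 * (k : ℝ) + 1) ≠ 0), mem_sphere_iff_norm, sub_zero] at hz
    have a1 := h₁ z (by rw [hz]; linarith)
    have a2 := h₂ z k hz (by rw [hz]; linarith)
    have a3 : ‖F z‖ * ‖D z - 2‖ = ‖n z‖ ^ 2 := by rw [← norm_mul, hFe z, Pi.pow_apply, norm_pow]
    have a4 : ‖n z‖ ^ 2 ≤ ε ^ 2 * Real.exp (|z.im| * Real.pi) := by
      calc ‖n z‖ ^ 2 ≤ (ε * Real.exp (|z.im| * (Real.pi / 2))) ^ 2 :=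
            pow_le_pow_left₀ (norm_nonneg _) a1 2
        _ = _ := by
            rw [mul_pow, ← Real.exp_nat_mul]
            congr 2
            push_cast
            ring
    have hE : 0 < Real.exp (|z.im| * Real.pi) := Real.exp_pos _
    have a5 : ‖F z‖ * (Real.exp (|z.im| * Real.pi) / 4) ≤ ε ^ 2 * Real.exp (|z.im| * Real.pi) :=
      (mul_le_mul_of_nonneg_left a2 (norm_nonneg _)).trans (a3.trans_le a4)
    have a6 : (‖F z‖ / 4) * Real.exp (|z.im| * Real.pi) ≤ ε ^ 2 * Real.exp (|z.im| * Real.pi) := by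
      linarith
    linarith [le_of_mul_le_mul_right a6 hE]
  have hF0 : F lam = 0 := by
    by_contra hne
    have hpos : 0 < ‖F lam‖ := norm_pos_iff.2 hne
    have := hbound (Real.sqrt (‖F lam‖ / 8)) (by positivity)
    rw [Real.sq_sqrt (by positivity)] at this
    linarith
  have := hFe lam
  rw [hF0, zero_mul] at this
  exact pow_eq_zero_iff two_ne_zero |>.1 this.symm

end EntireFunctions

end SelfAdjointSystem

namespace SelfAdjointSystem

attribute [local instance] Matrix.linftyOpNormedRing Matrix.linftyOpNormedAlgebra
attribute [local instance] normTopology normedAlgebraReal normedSpaceReal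

/-! ### Comparison of the two half periods and the inverse direction -/

namespace DiracPotential

variable (V : DiracPotential)

/-- The translated potential. -/
def shift (a : ℝ) : DiracPotential where
  p := fun t => V.p (t + a)
  r := fun t => V.r (t + a)
  p_int := fun s t => by simpa using (V.p_int (s + a) (t + a)).comp_add_right a
  r_int := fun s t => by simpa using (V.r_int (s + a) (t + a)).comp_add_right a

theorem fund_add (lam : ℂ) (a : ℝ) {t : ℝ} (ht : 0 ≤ t) :
    V.fund lam (t + a) = (V.shift a).fund lam t * V.fund lam a := by
  have h := (V.fund_isIntegralOf lam).comp_add_right a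
  simpa using (V.shift a).eq_fund_mul (Y := fun t => V.fund lam (t + a)) h ht

theorem mul_adjugate_fund (lam : ℂ) (x : ℝ) : V.fund lam x * (V.fund lam x).adjugate = 1 := by
  rw [mul_adjugate, V.det_fund, one_smul]

theorem adjugate_fund_mul (lam : ℂ) (x : ℝ) : (V.fund lam x).adjugate * V.fund lam x = 1 := by
  rw [adjugate_mul, V.det_fund, one_smul]

theorem norm_fund_entry_sub_rot_le {l : ℝ} (hl : 0 ≤ l) {ε : ℝ} (hε : 0 < ε) :
    ∃ R, ∀ lam : ℂ, R ≤ ‖lam‖ → ∀ i j,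
      ‖V.fund lam l i j - rot (-(lam * l)) i j‖ ≤ ε * Real.exp (|lam.im| * l) := by
  obtain ⟨R, hR⟩ := V.norm_fund_sub_rot_le hl hε
  exact ⟨R, fun lam hlam i j => (norm_entry_le (V.fund lam l - rot (-(lam * l))) i j).trans
    (hR lam hlam)⟩

/-- The discriminant is close to the free one on large circles of odd radius. -/
theorem exp_le_norm_disc_sub_two : ∃ R : ℝ, ∀ lam : ℂ, ∀ k : ℕ, ‖lam‖ = 2 * k + 1 → R ≤ ‖lam‖ →
    Real.exp (|lam.im| * Real.pi) / 4 ≤ ‖V.disc lam - 2‖ := by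
  obtain ⟨R, hR⟩ := V.norm_fund_entry_sub_rot_le Real.pi_pos.le (by norm_num : (0 : ℝ) < 1 / 8)
  refine ⟨R, fun lam k hk hlam => ?_⟩
  have h0 := hR lam hlam 0 0
  have h1 := hR lam hlam 1 1
  have h2 := exp_le_norm_two_sub_two_mul_cos hk
  have e : 2 - 2 * Complex.cos (lam * Real.pi) = -(V.disc lam - 2)
      + ((V.fund lam Real.pi 0 0 - rot (-(lam * Real.pi)) 0 0)
      + (V.fund lam Real.pi 1 1 - rot (-(lam * Real.pi)) 1 1)) := by
    rw [disc, trace_fin_two]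
    simp [rot]
    ring
  have h3 := norm_add_le (-(V.disc lam - 2)) ((V.fund lam Real.pi 0 0 - rot (-(lam * Real.pi)) 0 0)
      + (V.fund lam Real.pi 1 1 - rot (-(lam * Real.pi)) 1 1))
  have h4 := norm_add_le (V.fund lam Real.pi 0 0 - rot (-(lam * Real.pi)) 0 0)
    (V.fund lam Real.pi 1 1 - rot (-(lam * Real.pi)) 1 1)
  rw [← e, norm_neg] at h3
  linarith

theorem exists_disc_ne_two : ∃ lam : ℂ, V.disc lam ≠ 2 := by
  obtain ⟨R, hR⟩ := V.exp_le_norm_disc_sub_two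
  obtain ⟨k, hk⟩ := exists_nat_ge R
  have hn : ‖((2 * k + 1 : ℝ) : ℂ)‖ = 2 * k + 1 := by
    rw [Complex.norm_real, Real.norm_of_nonneg (by positivity)]
  refine ⟨((2 * k + 1 : ℝ) : ℂ), fun h => ?_⟩
  have h1 := hR _ k hn (by rw [hn]; linarith [k.cast_nonneg (α := ℝ)])
  rw [h, sub_self, norm_zero] at h1
  linarith [Real.exp_pos (|((2 * k + 1 : ℝ) : ℂ).im| * Real.pi)]

theorem fund_pi_eq_mul (lam : ℂ) : V.fund lam Real.pi =
    (V.shift (Real.pi / 2)).fund lam (Real.pi / 2) * V.fund lam (Real.pi / 2) := by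
  rw [← V.fund_add lam _ (by positivity), add_halves]

/-- The comparison matrix of the transfer matrices over the two half periods. -/
noncomputable def comparison (lam : ℂ) : M2 :=
  ((V.shift (Real.pi / 2)).fund lam (Real.pi / 2)).adjugate - V.fund lam (Real.pi / 2)

theorem comparison_eq_zero {lam : ℂ} (h : V.fund lam Real.pi = 1) : V.comparison lam = 0 := by
  rw [V.fund_pi_eq_mul] at h
  rw [comparison, sub_eq_zero]
  calc _ = ((V.shift (Real.pi / 2)).fund lam (Real.pi / 2)).adjugate *
        ((V.shift (Real.pi / 2)).fund lam (Real.pi / 2) * V.fund lam (Real.pi / 2)) := by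
        rw [h, mul_one]
    _ = _ := by rw [← mul_assoc, adjugate_fund_mul, one_mul]

theorem differentiable_comparison_entry (i j : Fin 2) :
    Differentiable ℂ fun lam => V.comparison lam i j := by
  have hp : 0 ≤ Real.pi / 2 := by positivity
  have hA := V.differentiable_fund_entry hp
  have hB := (V.shift (Real.pi / 2)).differentiable_fund_entry hp
  simp only [comparison, adjugate_fin_two]
  fin_cases i <;> fin_cases j
  · exact (hB 1 1).sub (hA 0 0)
  · exact (hB 0 1).neg.sub (hA 0 1)
  · exact (hB 1 0).neg.sub (hA 1 0)
  · exact (hB 0 0).sub (hA 1 1)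

variable {V}

/-- A zero with nonvanishing derivative would have order one. So the derivative vanishes, the
monodromy matrix is the identity, and the two half-period transfer matrices are inverse to each
other. -/
theorem comparison_eq_zero_of_disc_eq_two (hV : OnlyDoubleZeros fun lam => V.disc lam - 2)
    {lam : ℂ} (h : V.disc lam = 2) : V.comparison lam = 0 := by
  refine V.comparison_eq_zero (V.fund_eq_one_of_deriv_disc_eq_zero h ?_)
  by_contra hne
  have h2 := hV lam (sub_eq_zero.2 h)
  have han : AnalyticAt ℂ (fun lam => V.disc lam - 2) lam :=
    (V.differentiable_disc.sub_const 2).analyticAt lam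
  have h1 := han.analyticOrderAt_eq_one_of_zero_deriv_ne_zero (sub_eq_zero.2 h)
    (by rwa [deriv_sub_const])
  rw [h1] at h2
  exact absurd h2 (by decide)

/-- If all periodic eigenvalues are double, the comparison matrix is a multiple of `J`. -/
theorem comparison_eq_smul_J (hV : OnlyDoubleZeros fun lam => V.disc lam - 2) (lam : ℂ) :
    V.comparison lam = V.comparison lam 0 1 • J := by
  have hp : 0 ≤ Real.pi / 2 := by positivity
  -- In the free case both transfer matrices are `rot (-z)` with `z = lam π/2`, and the comparison
  -- matrix is `rot z - rot (-z) = 2 sin z J`.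
  have hasym : ∀ ε > 0, ∃ R : ℝ, ∀ lam : ℂ, R ≤ ‖lam‖ → ∀ i j,
      ‖V.comparison lam i j - (2 * Complex.sin (lam * (Real.pi / 2 : ℝ))) * J i j‖
        ≤ ε * Real.exp (|lam.im| * (Real.pi / 2)) := fun ε hε => by
    obtain ⟨R₁, h₁⟩ := V.norm_fund_entry_sub_rot_le hp (half_pos hε)
    obtain ⟨R₂, h₂⟩ := (V.shift (Real.pi / 2)).norm_fund_entry_sub_rot_le hp (half_pos hε)
    refine ⟨max R₁ R₂, fun lam hlam i j => ?_⟩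
    have hA := h₁ lam ((le_max_left _ _).trans hlam)
    have hB := h₂ lam ((le_max_right _ _).trans hlam)
    have key : ∀ a b c : ℂ, ‖a‖ ≤ ε / 2 * Real.exp (|lam.im| * (Real.pi / 2)) →
        ‖b‖ ≤ ε / 2 * Real.exp (|lam.im| * (Real.pi / 2)) → (c = a - b ∨ c = -a - b) →
        ‖c‖ ≤ ε * Real.exp (|lam.im| * (Real.pi / 2)) := fun a b c ha hb hc => by
      rcases hc with rfl | rfl
      · linarith [norm_sub_le a b]
      · have := norm_sub_le (-a) b
        rw [norm_neg] at this
        linarith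
    fin_cases i <;> fin_cases j
    · refine key _ _ _ (hB 1 1) (hA 0 0) (Or.inl ?_)
      simp [comparison, adjugate_fin_two, J, rot]
    · refine key _ _ _ (hB 0 1) (hA 0 1) (Or.inr ?_)
      simp [comparison, adjugate_fin_two, J, rot]
      ring
    · refine key _ _ _ (hB 1 0) (hA 1 0) (Or.inr ?_)
      simp [comparison, adjugate_fin_two, J, rot]
      ring
    · refine key _ _ _ (hB 0 0) (hA 1 1) (Or.inl ?_)
      simp [comparison, adjugate_fin_two, J, rot]
  have hz : ∀ lam, V.disc lam = 2 → ∀ i j, V.comparison lam i j = 0 := fun lam h i j => by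
    rw [comparison_eq_zero_of_disc_eq_two hV h]; rfl
  -- The two diagonal entries and the sum of the off-diagonal ones are the combinations annihilating
  -- `J`, so for them the leading term cancels and the uniqueness principle applies.
  have h00 := eq_zero_of_onlyDoubleZeros (V.differentiable_comparison_entry 0 0)
    V.differentiable_disc hV (fun lam h => hz lam h 0 0) (fun ε hε => by
      obtain ⟨R, hR⟩ := hasym ε hε
      exact ⟨R, fun lam hlam => by simpa [J] using hR lam hlam 0 0⟩) V.exp_le_norm_disc_sub_two lam
  have h11 := eq_zero_of_onlyDoubleZeros (V.differentiable_comparison_entry 1 1)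
    V.differentiable_disc hV (fun lam h => hz lam h 1 1) (fun ε hε => by
      obtain ⟨R, hR⟩ := hasym ε hε
      exact ⟨R, fun lam hlam => by simpa [J] using hR lam hlam 1 1⟩) V.exp_le_norm_disc_sub_two lam
  have hs := eq_zero_of_onlyDoubleZeros
    ((V.differentiable_comparison_entry 0 1).add (V.differentiable_comparison_entry 1 0))
    V.differentiable_disc hV (fun lam h => by simp [hz lam h]) (fun ε hε => by
      obtain ⟨R, hR⟩ := hasym (ε / 2) (half_pos hε)
      refine ⟨R, fun lam hlam => ?_⟩
      have a1 := hR lam hlam 0 1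
      have a2 := hR lam hlam 1 0
      have a3 := norm_add_le
        (V.comparison lam 0 1 - (2 * Complex.sin (lam * (Real.pi / 2 : ℝ))) * J 0 1)
        (V.comparison lam 1 0 - (2 * Complex.sin (lam * (Real.pi / 2 : ℝ))) * J 1 0)
      rw [show (V.comparison lam 0 1 - (2 * Complex.sin (lam * (Real.pi / 2 : ℝ))) * J 0 1) +
        (V.comparison lam 1 0 - (2 * Complex.sin (lam * (Real.pi / 2 : ℝ))) * J 1 0)
        = V.comparison lam 0 1 + V.comparison lam 1 0 by simp [J]] at a3
      simp only [Pi.add_apply]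
      linarith) V.exp_le_norm_disc_sub_two lam
  simp only [Pi.add_apply] at hs
  ext i j
  fin_cases i <;> fin_cases j
  · simp [J, h00]
  · simp [J]
  · simp [J, eq_neg_of_add_eq_zero_right hs]
  · simp [J, h11]

/-- Translating a periodic potential conjugates its monodromy matrix. -/
theorem shift_fund_pi (hper : V.shift Real.pi = V) (lam : ℂ) {x : ℝ} (hx : 0 ≤ x) :
    (V.shift x).fund lam Real.pi = V.fund lam x * V.fund lam Real.pi * (V.fund lam x).adjugate := by
  have h1 := V.fund_add lam x Real.pi_pos.le
  have h2 := V.fund_add lam Real.pi hx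
  rw [hper] at h2
  rw [add_comm, h2] at h1
  rw [h1, mul_assoc, mul_adjugate_fund, mul_one]

theorem shift_disc (hper : V.shift Real.pi = V) {x : ℝ} (hx : 0 ≤ x) :
    (V.shift x).disc = V.disc := by
  funext lam
  rw [disc, disc, shift_fund_pi hper lam hx, trace_mul_comm, ← mul_assoc, adjugate_fund_mul, one_mul]

/-- The middle factor does not depend on the translation, so the determinant of the left side does
not depend on `x`. -/
theorem shift_comparison (hper : V.shift Real.pi = V) (lam : ℂ) {x : ℝ} (hx : 0 ≤ x) :
    (V.shift x).comparison lam = V.fund lam (x + Real.pi / 2) *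
      ((V.fund lam Real.pi).adjugate - 1) * (V.fund lam x).adjugate := by
  have hp : 0 ≤ Real.pi / 2 := by positivity
  have hA : (V.shift x).fund lam (Real.pi / 2)
      = V.fund lam (x + Real.pi / 2) * (V.fund lam x).adjugate := by
    rw [add_comm, V.fund_add lam x hp, mul_assoc, mul_adjugate_fund, mul_one]
  have hB : (((V.shift x).shift (Real.pi / 2)).fund lam (Real.pi / 2)).adjugate
      = (V.shift x).fund lam (Real.pi / 2) * ((V.shift x).fund lam Real.pi).adjugate := by
    rw [fund_pi_eq_mul, adjugate_mul_distrib, ← mul_assoc, mul_adjugate_fund, one_mul]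
  have hadj : (V.fund lam x).adjugate.adjugate = V.fund lam x := by
    simp [adjugate_fin_two, ← eta_fin_two]
  rw [comparison, hB, shift_fund_pi hper lam hx, hA, adjugate_mul_distrib, adjugate_mul_distrib,
    hadj]
  calc _ = V.fund lam (x + Real.pi / 2) * ((V.fund lam x).adjugate * V.fund lam x)
        * (V.fund lam Real.pi).adjugate * (V.fund lam x).adjugate
        - V.fund lam (x + Real.pi / 2) * (V.fund lam x).adjugate := by
        simp only [mul_assoc]
    _ = _ := by rw [adjugate_fund_mul, mul_one, mul_sub, mul_one, sub_mul]

/-- If all periodic eigenvalues are double, the solutions over the second half period are obtained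
from those over the first one. -/
theorem exists_fund_add_half_mul_eq (hper : V.shift Real.pi = V)
    (hV : OnlyDoubleZeros fun lam => V.disc lam - 2) {lam : ℂ} (hl : V.disc lam ≠ 2) :
    ∃ (K : M2) (h : ℂ), h ≠ 0 ∧ ∀ x, 0 ≤ x →
      V.fund lam (x + Real.pi / 2) * K = h • (J * V.fund lam x) := by
  set K : M2 := (V.fund lam Real.pi).adjugate - 1 with hK
  have hKdet : K.det = 2 - V.disc lam := by
    have h1 := V.det_fund lam Real.pi
    rw [det_fin_two] at h1
    rw [hK, disc, trace_fin_two, det_fin_two, adjugate_fin_two]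
    simp
    linear_combination h1
  -- In this form the adjugate is visibly continuous.
  have hadj : ∀ A : M2, A.adjugate = J * (-(Aᵀ * J)) := fun A => by
    rw [adjugate_fin_two]
    ext i j
    fin_cases i <;> fin_cases j <;> simp [J, Matrix.mul_apply, Fin.sum_univ_two]
  have hcont : Continuous fun x => V.fund lam (x + Real.pi / 2) * K * (V.fund lam x).adjugate := by
    simp only [hadj]
    exact (((V.fund_continuous lam).comp (continuous_id.add continuous_const)).mul
      continuous_const).mul (continuous_const.mul (((transposeCLM.continuous.comp
        (V.fund_continuous lam)).mul continuous_const).neg))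
  set h : ℝ → ℂ := fun x => (V.fund lam (x + Real.pi / 2) * K * (V.fund lam x).adjugate) 0 1
  have hhc : Continuous h := (entryCLM 0 1).continuous.comp hcont
  have hC : ∀ x, 0 ≤ x →
      V.fund lam (x + Real.pi / 2) * K * (V.fund lam x).adjugate = h x • J := fun x hx => by
    have h1 := comparison_eq_smul_J (V := V.shift x) (by rwa [shift_disc hper hx]) lam
    rwa [shift_comparison hper lam hx] at h1
  have hsq : ∀ x, 0 ≤ x → h x ^ 2 = 2 - V.disc lam := fun x hx => by
    have h1 := congrArg Matrix.det (hC x hx)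
    rw [det_mul, det_mul, V.det_fund, det_adjugate, V.det_fund, hKdet] at h1
    simpa [det_fin_two, J, pow_two] using h1.symm
  have h0 : h 0 ≠ 0 := fun h0 => by
    have := hsq 0 le_rfl
    rw [h0, zero_pow two_ne_zero] at this
    exact hl (sub_eq_zero.1 this.symm).symm
  -- A continuous square root of a nonzero constant cannot change sign on a connected set.
  have hconst : ∀ x, 0 ≤ x → h x = h 0 := by
    have := (isPreconnected_Ici (a := (0 : ℝ))).eq_or_eq_neg_of_sq_eq hhc.continuousOn
      (continuousOn_const (c := h 0)) (fun x hx => by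
        simp only [Pi.pow_apply]
        rw [hsq x hx, hsq 0 le_rfl]) fun _ => h0
    rcases this with h1 | h1
    · exact fun x hx => h1 hx
    · have h2 := h1 (mem_Ici.2 le_rfl)
      simp only [Pi.neg_apply] at h2
      exact absurd (self_eq_neg.1 h2) h0
  refine ⟨K, h 0, h0, fun x hx => ?_⟩
  have h1 := congrArg (· * V.fund lam x) (hC x hx)
  rw [mul_assoc, adjugate_fund_mul, mul_one, hconst x hx, smul_mul_assoc] at h1
  exact h1

/-- The identities for the fundamental solution are available only to the right of the origin;
periodicity carries the conclusion to the whole line. -/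
theorem ae_of_ae_pos_of_periodic {P : ℝ → Prop} {T : ℝ} (hT : 0 < T)
    (hP : ∀ x, P (x + T) ↔ P x) (h : ∀ᵐ x : ℝ, 0 < x → P x) : ∀ᵐ x : ℝ, P x := by
  have hn : ∀ n : ℕ, ∀ x, P (x + n * T) ↔ P x := fun n => by
    induction n with
    | zero => simp
    | succ n ih =>
      intro x
      rw [← ih x, ← hP (x + n * T)]
      push_cast
      ring_nf
  have hall : ∀ᵐ x : ℝ, ∀ n : ℕ, 0 < x + n * T → P (x + n * T) := by
    rw [ae_all_iff]
    intro n
    exact (measurePreserving_add_right volume (n * T)).quasiMeasurePreserving.ae h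
  filter_upwards [hall] with x hx
  obtain ⟨n, hn'⟩ := exists_nat_gt (-x / T)
  rw [div_lt_iff₀ hT] at hn'
  exact (hn n x).1 (hx n (by linarith))

/-- If all periodic eigenvalues are double, the potential is antiperiodic over the half period. -/
theorem antiperiodic_of_onlyDoubleZeros (hper : V.shift Real.pi = V)
    (hV : OnlyDoubleZeros fun lam => V.disc lam - 2) :
    ∀ᵐ x, V.mat (x + Real.pi / 2) = -V.mat x := by
  obtain ⟨lam, hl⟩ := V.exists_disc_ne_two
  obtain ⟨K, h, hh, hrel⟩ := exists_fund_add_half_mul_eq hper hV hl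
  have hpp : ∀ x, V.p (x + Real.pi) = V.p x := fun x => congrFun (congrArg DiracPotential.p hper) x
  have hrr : ∀ x, V.r (x + Real.pi) = V.r x := fun x => congrFun (congrArg DiracPotential.r hper) x
  have hmat : ∀ x, V.mat (x + Real.pi) = V.mat x := fun x => by simp [mat, hpp, hrr]
  refine ae_of_ae_pos_of_periodic Real.pi_pos (fun x => ?_) ?_
  · rw [hmat, add_right_comm, hmat]
  have d1 := (((V.fund_isIntegralOf lam).comp_add_right (Real.pi / 2)).mul_const K).ae_hasDerivAt
  have d2 := ((V.fund_isIntegralOf lam).const_mul (h • J)).ae_hasDerivAt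
  filter_upwards [d1, d2] with x h1 h2 hx
  have hev : (fun x => V.fund lam (x + Real.pi / 2) * K) =ᶠ[𝓝 x] fun x => h • J * V.fund lam x := by
    filter_upwards [eventually_gt_nhds hx] with y hy
    rw [hrel y hy.le, smul_mul_assoc]
  have h3 := (h2.congr_of_eventuallyEq hev).unique h1
  -- Both derivatives of `M(x + π/2) K = h J M(x)` are compared, and `h` and `M(x)` are cancelled.
  -- The spectral parameter drops out of the resulting entries.
  have h4 : J * V.coef lam x = V.coef lam (x + Real.pi / 2) * J := by
    rw [mul_assoc (V.coef lam _), hrel x hx.le, mul_smul_comm, smul_mul_assoc] at h3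
    have h5 := smul_right_injective M2 hh h3
    have h6 := congrArg (· * (V.fund lam x).adjugate) h5
    simpa only [mul_assoc, mul_adjugate_fund, mul_one] using h6
  rw [coef_eq, coef_eq] at h4
  have e00 := congrFun (congrFun h4 0) 0
  have e01 := congrFun (congrFun h4 0) 1
  simp [J, Matrix.mul_apply, Fin.sum_univ_two] at e00 e01
  have hp : (V.p (x + Real.pi / 2) : ℂ) = -V.p x := by linear_combination -e00
  have hr : (V.r (x + Real.pi / 2) : ℂ) = -V.r x := by linear_combination -e01
  ext i j
  fin_cases i <;> fin_cases j <;> simp [mat, hp, hr]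

end DiracPotential

end SelfAdjointSystem

namespace SelfAdjointSystem

/-! ### The gauge transformation in closed form -/

section GaugeFormula

/-- The matrix is `α J - iβ`, which the eigenvectors `(1, ±i)` of `J` diagonalise with eigenvalues
`±iα - iβ`. -/
theorem exp_eq_smul_rot (α β : ℂ) :
    NormedSpace.exp (!![-Complex.I * β, α; -α, -Complex.I * β] : M2)
      = Complex.exp (-Complex.I * β) • rot α := by
  set U : M2 := !![1, 1; Complex.I, -Complex.I] with hU
  have hdet : U.det = -2 * Complex.I := by
    rw [hU, det_fin_two_of]; ring
  have hUd : IsUnit U.det := by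
    rw [hdet]
    exact isUnit_iff_ne_zero.2 (by simp)
  have hunit : IsUnit U := (isUnit_iff_isUnit_det U).2 hUd
  have hconj : (!![-Complex.I * β, α; -α, -Complex.I * β] : M2)
      = U * diagonal ![Complex.I * (α - β), -Complex.I * (α + β)] * U⁻¹ := by
    rw [← mul_nonsing_inv_cancel_right U !![-Complex.I * β, α; -α, -Complex.I * β] hUd]
    congr 1
    ext i j
    fin_cases i <;> fin_cases j <;> simp [hU, Matrix.mul_apply, Fin.sum_univ_two] <;>
      ring_nf <;> simp
  rw [hconj, exp_conj U _ hunit, exp_diagonal,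
    ← mul_nonsing_inv_cancel_right U (Complex.exp (-Complex.I * β) • rot α) hUd]
  congr 1
  have e1 : Complex.exp (Complex.I * (α - β)) = Complex.exp (-Complex.I * β)
      * (Complex.cos α + Complex.sin α * Complex.I) := by
    rw [← Complex.exp_mul_I, ← Complex.exp_add]
    congr 1
    ring
  have e2 : Complex.exp (-Complex.I * (α + β)) = Complex.exp (-Complex.I * β)
      * (Complex.cos α - Complex.sin α * Complex.I) := by
    rw [Complex.cos_sub_sin_I, ← Complex.exp_add]
    congr 1
    ring
  have e3 : NormedSpace.exp ![Complex.I * (α - β), -Complex.I * (α + β)]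
      = ![Complex.exp (Complex.I * (α - β)), Complex.exp (-Complex.I * (α + β))] := by
    rw [Complex.exp_eq_exp_ℂ]
    ext i
    rw [Pi.coe_exp]
    fin_cases i <;> rfl
  rw [e3, e1, e2]
  ext i j
  fin_cases i <;> fin_cases j <;>
    simp [hU, rot, Matrix.mul_apply, Fin.sum_univ_two] <;> ring_nf <;> simp <;> ring

end GaugeFormula

/-! ### Chain rule for phases and rotations -/

section ChainRule

variable {G g : ℝ → ℝ}

theorem IsIntegralOf.cos (h : IsIntegralOf G g) :
    IsIntegralOf (fun x => Real.cos (G x)) fun x => -Real.sin (G x) * g x := by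
  refine .of_absolutelyContinuous (fun a b => absolutelyContinuousOnInterval_of_dist_le
    (h.absolutelyContinuousOnInterval a b) fun x y => Real.abs_cos_sub_cos_le _ _) ?_ fun a b => ?_
  · filter_upwards [h.ae_hasDerivAt] with x hx using hx.cos
  · exact (h.intervalIntegrable a b).continuousOn_mul
      (Real.continuous_sin.comp h.continuous).neg.continuousOn

theorem IsIntegralOf.sin (h : IsIntegralOf G g) :
    IsIntegralOf (fun x => Real.sin (G x)) fun x => Real.cos (G x) * g x := by
  refine .of_absolutelyContinuous (fun a b => absolutelyContinuousOnInterval_of_dist_le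
    (h.absolutelyContinuousOnInterval a b) fun x y => Real.abs_sin_sub_sin_le _ _) ?_ fun a b => ?_
  · filter_upwards [h.ae_hasDerivAt] with x hx using hx.sin
  · exact (h.intervalIntegrable a b).continuousOn_mul
      (Real.continuous_cos.comp h.continuous).continuousOn

theorem IsIntegralOf.ofReal (h : IsIntegralOf G g) :
    IsIntegralOf (fun x => (G x : ℂ)) fun x => (g x : ℂ) :=
  h.clm_comp Complex.ofRealCLM

theorem IsIntegralOf.exp_neg_I_mul (h : IsIntegralOf G g) :
    IsIntegralOf (fun x => Complex.exp (-Complex.I * G x))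
      fun x => -Complex.I * g x * Complex.exp (-Complex.I * G x) := by
  have e : ∀ x, Complex.exp (-Complex.I * G x)
      = (Real.cos (G x) : ℂ) - (Real.sin (G x) : ℂ) * Complex.I := fun x => by
    rw [Complex.ofReal_cos, Complex.ofReal_sin, Complex.cos_sub_sin_I]
    ring_nf
  simp only [e]
  convert h.cos.ofReal.sub (h.sin.ofReal.mul_const Complex.I) using 2 with x
  push_cast
  linear_combination (Complex.sin (G x) * g x) * Complex.I_sq

end ChainRule

attribute [local instance] Matrix.linftyOpNormedRing Matrix.linftyOpNormedAlgebra
attribute [local instance] normTopology normedAlgebraReal normedSpaceReal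

theorem IsIntegralOf.rot {G g : ℝ → ℝ} (h : IsIntegralOf G g) :
    IsIntegralOf (fun x => rot (G x)) fun x => (g x : ℂ) • (J * rot (G x)) := by
  have hc := h.cos.ofReal
  have hs := h.sin.ofReal
  have h00 : IsIntegralOf (fun x => SelfAdjointSystem.rot (G x) 0 0)
      fun x => ((g x : ℂ) • (J * SelfAdjointSystem.rot (G x))) 0 0 := by
    convert hc using 2 with x <;> simp [J_mul_eq, SelfAdjointSystem.rot, mul_comm]
  have h01 : IsIntegralOf (fun x => SelfAdjointSystem.rot (G x) 0 1)
      fun x => ((g x : ℂ) • (J * SelfAdjointSystem.rot (G x))) 0 1 := by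
    convert hs using 2 with x <;> simp [J_mul_eq, SelfAdjointSystem.rot, mul_comm]
  have h10 : IsIntegralOf (fun x => SelfAdjointSystem.rot (G x) 1 0)
      fun x => ((g x : ℂ) • (J * SelfAdjointSystem.rot (G x))) 1 0 := by
    have hn := (IsIntegralOf.const (0 : ℂ)).sub hs
    simp only [zero_sub] at hn
    convert hn using 2 with x <;> simp [J_mul_eq, SelfAdjointSystem.rot, mul_comm]
  have h11 : IsIntegralOf (fun x => SelfAdjointSystem.rot (G x) 1 1)
      fun x => ((g x : ℂ) • (J * SelfAdjointSystem.rot (G x))) 1 1 := by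
    convert hc using 2 with x <;> simp [J_mul_eq, SelfAdjointSystem.rot, mul_comm]
  refine isIntegralOf_matrix fun i j => ?_
  fin_cases i <;> fin_cases j
  exacts [h00, h01, h10, h11]

theorem intervalIntegrable_entry {f : ℝ → M2} {a b : ℝ} (hf : IntervalIntegrable f volume a b)
    (i j : Fin 2) : IntervalIntegrable (fun x => f x i j) volume a b :=
  ⟨(entryCLM i j).integrable_comp hf.1, (entryCLM i j).integrable_comp hf.2⟩

/-- Hermitian, `π`-periodic and locally integrable coefficient matrices. -/
structure IsPeriodicHermitian (Q : ℝ → M2) : Prop where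
  isHermitian : ∀ x, (Q x).IsHermitian
  periodic : Function.Periodic Q Real.pi
  integrableOn : ∀ i j : Fin 2, IntegrableOn (fun x => Q x i j) (Ico 0 Real.pi) volume

/-- The coefficient of the identity matrix in `Q`. -/
noncomputable def scalarPart (Q : ℝ → M2) (x : ℝ) : ℝ := ((Q x 0 0).re + (Q x 1 1).re) / 2

/-- The coefficient of `σ₃` in `Q`. -/
noncomputable def diagonalPart (Q : ℝ → M2) (x : ℝ) : ℝ := ((Q x 0 0).re - (Q x 1 1).re) / 2

/-- The mean value of the coefficient of the identity matrix. -/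
noncomputable def scalarMean (Q : ℝ → M2) : ℝ := Real.pi⁻¹ * ∫ t in (0 : ℝ)..Real.pi, scalarPart Q t

/-- The rotation angle of the gauge transformation. -/
noncomputable def angle (Q : ℝ → M2) (x : ℝ) : ℝ :=
  ∫ t in (0 : ℝ)..x, (scalarPart Q t - scalarMean Q)

/-- The mean value of the imaginary part of the off-diagonal entry. -/
noncomputable def imMean (Q : ℝ → M2) : ℝ := Real.pi⁻¹ * ∫ t in (0 : ℝ)..Real.pi, (Q t 0 1).im

/-- The phase of the scalar factor of the gauge transformation. -/
noncomputable def imAngle (Q : ℝ → M2) (x : ℝ) : ℝ :=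
  ∫ t in (0 : ℝ)..x, ((Q t 0 1).im - imMean Q)

/-! ### Reduction of the Hermitian system to the canonical one -/

namespace IsPeriodicHermitian

variable {Q : ℝ → M2}

theorem entry_intervalIntegrable (h : IsPeriodicHermitian Q) (i j : Fin 2) (a b : ℝ) :
    IntervalIntegrable (fun x => Q x i j) volume a b := by
  have hp : Function.Periodic (fun x => Q x i j) Real.pi := fun x => by simp only [h.periodic x]
  refine hp.intervalIntegrable₀ Real.pi_ne_zero ?_ a b
  rw [intervalIntegrable_iff_integrableOn_Ico_of_le Real.pi_pos.le]
  exact h.integrableOn i j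

theorem re_intervalIntegrable (h : IsPeriodicHermitian Q) (i j : Fin 2) (a b : ℝ) :
    IntervalIntegrable (fun x => (Q x i j).re) volume a b :=
  ⟨(h.entry_intervalIntegrable i j a b).1.re, (h.entry_intervalIntegrable i j a b).2.re⟩

theorem im_intervalIntegrable (h : IsPeriodicHermitian Q) (i j : Fin 2) (a b : ℝ) :
    IntervalIntegrable (fun x => (Q x i j).im) volume a b :=
  ⟨(h.entry_intervalIntegrable i j a b).1.im, (h.entry_intervalIntegrable i j a b).2.im⟩

theorem scalarPart_intervalIntegrable (h : IsPeriodicHermitian Q) (a b : ℝ) :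
    IntervalIntegrable (scalarPart Q) volume a b :=
  ((h.re_intervalIntegrable 0 0 a b).add (h.re_intervalIntegrable 1 1 a b)).div_const 2

theorem diagonalPart_intervalIntegrable (h : IsPeriodicHermitian Q) (a b : ℝ) :
    IntervalIntegrable (diagonalPart Q) volume a b :=
  ((h.re_intervalIntegrable 0 0 a b).sub (h.re_intervalIntegrable 1 1 a b)).div_const 2

theorem diag_eq (h : IsPeriodicHermitian Q) (x : ℝ) (i : Fin 2) : Q x i i = ((Q x i i).re : ℂ) :=
  (Complex.conj_eq_iff_re.1 ((h.isHermitian x).apply i i)).symm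

theorem Q1_eq (h : IsPeriodicHermitian Q) (x : ℝ) : Q1 Q x = !![(diagonalPart Q x : ℂ), ((Q x 0 1).re : ℂ);
    ((Q x 0 1).re : ℂ), -(diagonalPart Q x : ℂ)] := by
  rw [Q1, h.diag_eq x 0, h.diag_eq x 1]
  ext i j
  fin_cases i <;> fin_cases j <;> simp [pauli1, pauli3, diagonalPart]

theorem Q2_eq (h : IsPeriodicHermitian Q) (x : ℝ) : Q2 Q x = !![(scalarPart Q x : ℂ), Complex.I * (Q x 0 1).im;
    -Complex.I * (Q x 0 1).im, (scalarPart Q x : ℂ)] := by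
  rw [Q2, h.diag_eq x 0, h.diag_eq x 1]
  ext i j
  fin_cases i <;> fin_cases j <;> simp [pauli2, scalarPart, mul_comm]

theorem Q1_add_Q2 (h : IsPeriodicHermitian Q) (x : ℝ) : Q1 Q x + Q2 Q x = Q x := by
  have h10 : Q x 1 0 = (Q x 0 1).re - (Q x 0 1).im * Complex.I := by
    rw [← (h.isHermitian x).apply 1 0]
    apply Complex.ext <;> simp
  have h00 := h.diag_eq x 0
  have h11 := h.diag_eq x 1
  have h01 := Complex.re_add_im (Q x 0 1)
  rw [h.Q1_eq, h.Q2_eq]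
  ext i j
  fin_cases i <;> fin_cases j <;> simp [diagonalPart, scalarPart]
  · linear_combination -h00
  · linear_combination h01
  · linear_combination -h10
  · linear_combination -h11

theorem angle_isIntegralOf (h : IsPeriodicHermitian Q) :
    IsIntegralOf (angle Q) fun x => scalarPart Q x - scalarMean Q :=
  isIntegralOf_integral fun s t => (h.scalarPart_intervalIntegrable s t).sub intervalIntegrable_const

theorem angle_pi (h : IsPeriodicHermitian Q) : angle Q Real.pi = 0 := by
  rw [angle, integral_sub (h.scalarPart_intervalIntegrable _ _) intervalIntegrable_const, scalarMean]
  simp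

/-- The potential after the gauge transformation. -/
noncomputable def potential (h : IsPeriodicHermitian Q) : DiracPotential where
  -- `Q₁` anticommutes with `J`, so `rot (-θ) Q₁ rot θ = Q₁ rot (2 θ)`; these are the entries of its
  -- first row.
  p x := Real.cos (2 * angle Q x) * diagonalPart Q x - Real.sin (2 * angle Q x) * (Q x 0 1).re
  r x := Real.sin (2 * angle Q x) * diagonalPart Q x + Real.cos (2 * angle Q x) * (Q x 0 1).re
  p_int a b := by
    have hc := h.angle_isIntegralOf.continuous
    exact ((h.diagonalPart_intervalIntegrable a b).continuousOn_mul
      (Continuous.continuousOn (by fun_prop))).sub ((h.re_intervalIntegrable 0 1 a b).continuousOn_mul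
      (Continuous.continuousOn (by fun_prop)))
  r_int a b := by
    have hc := h.angle_isIntegralOf.continuous
    exact ((h.diagonalPart_intervalIntegrable a b).continuousOn_mul
      (Continuous.continuousOn (by fun_prop))).add ((h.re_intervalIntegrable 0 1 a b).continuousOn_mul
      (Continuous.continuousOn (by fun_prop)))

theorem rot_mul_potential (h : IsPeriodicHermitian Q) (x : ℝ) :
    rot (angle Q x) * h.potential.mat x = Q1 Q x * rot (angle Q x) := by
  have hcs := Complex.cos_sq_add_sin_sq (angle Q x : ℂ)
  rw [h.Q1_eq, DiracPotential.mat, potential, rot]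
  ext i j
  fin_cases i <;> fin_cases j <;>
    simp [Matrix.mul_apply, Fin.sum_univ_two, Complex.cos_two_mul, Complex.sin_two_mul]
  · linear_combination (2 * Complex.cos (angle Q x) * diagonalPart Q x) * hcs
  · linear_combination (2 * Complex.cos (angle Q x) * (Q x 0 1).re) * hcs
  · linear_combination (2 * Complex.cos (angle Q x) * (Q x 0 1).re) * hcs
  · linear_combination (-2 * Complex.cos (angle Q x) * diagonalPart Q x) * hcs

theorem meanQ2_eq (h : IsPeriodicHermitian Q) : meanQ2 Q =
    !![(scalarMean Q : ℂ), Complex.I * (imMean Q : ℝ);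
      -Complex.I * (imMean Q : ℝ), (scalarMean Q : ℂ)] := by
  simp only [meanQ2, matIntegral, h.Q2_eq]
  ext i j
  fin_cases i <;> fin_cases j <;> simp [scalarMean, imMean, intervalIntegral.integral_ofReal, mul_left_comm]

theorem J_mul_matIntegral (h : IsPeriodicHermitian Q) (z : ℝ) :
    J * matIntegral (fun t => Q2 Q t - meanQ2 Q) z =
      !![-Complex.I * (imAngle Q z : ℝ), angle Q z; -angle Q z, -Complex.I * (imAngle Q z : ℝ)] := by
  simp only [matIntegral, h.Q2_eq, h.meanQ2_eq, J_mul_eq, imAngle, angle]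
  have e (t : ℝ) : Complex.I * (Q t 0 1).im - Complex.I * imMean Q
      = Complex.I * (((Q t 0 1).im - imMean Q : ℝ) : ℂ) := by push_cast; ring
  have e' (t : ℝ) : (scalarPart Q t : ℂ) - scalarMean Q
      = ((scalarPart Q t - scalarMean Q : ℝ) : ℂ) := by push_cast; ring
  have e'' (t : ℝ) : Complex.I * imMean Q - Complex.I * (Q t 0 1).im
      = -(Complex.I * (((Q t 0 1).im - imMean Q : ℝ) : ℂ)) := by push_cast; ring
  ext i j
  fin_cases i <;> fin_cases j <;>
    simp [e, e', e'', neg_add_eq_sub, intervalIntegral.integral_ofReal, -Complex.ofReal_sub]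

theorem R_eq (h : IsPeriodicHermitian Q) (z : ℝ) :
    R Q z = Complex.exp (-Complex.I * (imAngle Q z : ℝ)) • rot (angle Q z) := by
  rw [← exp_eq_smul_rot, R, h.J_mul_matIntegral]

/-- The scalar phase in `R` cancels in the conjugation, so only the rotation acts. -/
theorem Q1tilde_eq (h : IsPeriodicHermitian Q) (z : ℝ) : Q1tilde Q z = h.potential.mat z := by
  have hR : IsUnit (R Q z).det := by
    rw [h.R_eq, det_smul]
    refine isUnit_iff_ne_zero.2 (mul_ne_zero (pow_ne_zero _ (Complex.exp_ne_zero _)) ?_)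
    rw [rot, det_fin_two_of]
    intro h0
    have := Complex.cos_sq_add_sin_sq (angle Q z : ℂ)
    exact one_ne_zero (this.symm.trans (by linear_combination h0))
  have e : Q1 Q z * R Q z = R Q z * h.potential.mat z := by
    rw [h.R_eq, Matrix.mul_smul, Matrix.smul_mul, h.rot_mul_potential]
  rw [Q1tilde, mul_assoc, e, nonsing_inv_mul_cancel_left _ _ hR]

theorem angle_periodic (h : IsPeriodicHermitian Q) : Function.Periodic (angle Q) Real.pi := by
  intro x
  have hp : Function.Periodic (fun t => scalarPart Q t - scalarMean Q) Real.pi := fun t => by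
    simp only [scalarPart, h.periodic t]
  have h1 := h.angle_isIntegralOf.sub_eq x (x + Real.pi)
  rw [hp.intervalIntegral_add_eq x 0, zero_add] at h1
  exact sub_eq_zero.1 (h1.trans h.angle_pi)

theorem shift_potential (h : IsPeriodicHermitian Q) : h.potential.shift Real.pi = h.potential := by
  simp only [potential, DiracPotential.shift, h.angle_periodic _, diagonalPart, h.periodic _]

/-- The fundamental matrix in terms of the gauge transformed potential. -/
noncomputable def gaugedFund (h : IsPeriodicHermitian Q) (lam : ℂ) (x : ℝ) : M2 :=
  -- Unlike in `R`, the phase is not centred: it removes `Im q` entirely, whereas the mean of `(q₁ +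
  -- q₂)/2` is kept as a shift of the spectral parameter.
  Complex.exp (-Complex.I * (∫ t in (0 : ℝ)..x, (Q t 0 1).im : ℝ)) • rot (angle Q x) * h.potential.fund (lam - scalarMean Q) x

theorem gaugedFund_zero (h : IsPeriodicHermitian Q) (lam : ℂ) : h.gaugedFund lam 0 = 1 := by
  ext i j
  simp [gaugedFund, angle, DiracPotential.fund_zero]

theorem coef_intervalIntegrable (h : IsPeriodicHermitian Q) (lam : ℂ) (a b : ℝ) :
    IntervalIntegrable (fun x => J * (Q x - lam • (1 : M2))) volume a b := by
  refine intervalIntegrable_matrix (fun i j a b => ?_) a b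
  have hq (i j : Fin 2) : IntervalIntegrable (fun x => (Q x - lam • (1 : M2)) i j) volume a b :=
    (h.entry_intervalIntegrable i j a b).sub intervalIntegrable_const
  simp only [J_mul_eq]
  fin_cases i <;> fin_cases j
  exacts [hq 1 0, hq 1 1, (hq 0 0).neg, (hq 0 1).neg]

theorem gaugedFund_isIntegralOf (h : IsPeriodicHermitian Q) (lam : ℂ) :
    IsIntegralOf (h.gaugedFund lam) fun x => J * (Q x - lam • (1 : M2)) * h.gaugedFund lam x := by
  have hE := (isIntegralOf_integral (h.im_intervalIntegrable 0 1)).exp_neg_I_mul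
  have hF : IsIntegralOf
      (fun x => Complex.exp (-Complex.I * (∫ t in (0 : ℝ)..x, (Q t 0 1).im : ℝ)) • rot (angle Q x))
      fun x => (-Complex.I * (Q x 0 1).im
          * Complex.exp (-Complex.I * (∫ t in (0 : ℝ)..x, (Q t 0 1).im : ℝ))) • rot (angle Q x)
        + Complex.exp (-Complex.I * (∫ t in (0 : ℝ)..x, (Q t 0 1).im : ℝ))
          • ((scalarPart Q x - scalarMean Q : ℝ) : ℂ) • (J * rot (angle Q x)) :=
    isIntegralOf_matrix fun i j => hE.mul (h.angle_isIntegralOf.rot.entry i j)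
  refine (hF.mul (h.potential.fund_isIntegralOf (lam - scalarMean Q))).congr_ae
    (Eventually.of_forall fun x => ?_)
  have hg := h.rot_mul_potential x
  have hq := h.Q1_add_Q2 x
  simp only [gaugedFund, ← mul_assoc, ← add_mul]
  congr 1
  set e := Complex.exp (-Complex.I * (∫ t in (0 : ℝ)..x, (Q t 0 1).im : ℝ))
  set S := rot (angle Q x)
  -- The scalar term is the derivative of the phase; the `J` term is that of the rotation plus the
  -- mean moved into the spectral parameter.
  have hJ2 : J * Q2 Q x = (scalarPart Q x : ℂ) • J + (-Complex.I * (Q x 0 1).im) • (1 : M2) := by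
    rw [h.Q2_eq, J_mul_eq]
    ext i j
    fin_cases i <;> fin_cases j <;> simp [J]
  have hJS : S * (J * h.potential.mat x) = J * Q1 Q x * S := by
    rw [← mul_assoc, ← J_mul_rot, mul_assoc, hg, mul_assoc]
  have hE2 : J * (Q1 Q x + Q2 Q x - lam • (1 : M2)) * S = J * Q1 Q x * S
      + (scalarPart Q x : ℂ) • (J * S) + (-Complex.I * (Q x 0 1).im) • S - lam • (J * S) := by
    rw [mul_sub, mul_add, hJ2, sub_mul, add_mul, add_mul]
    simp only [Matrix.smul_mul, Matrix.mul_smul, mul_one, one_mul]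
    module
  have hE3 : S * (J * (h.potential.mat x - (lam - scalarMean Q) • (1 : M2))) = J * Q1 Q x * S
      - (lam - scalarMean Q) • (J * S) := by
    have hS : J * S = S * J := J_mul_rot _
    rw [mul_sub, mul_sub, hJS, hS]
    simp only [Matrix.mul_smul, mul_one]
  rw [hq] at hE2
  rw [DiracPotential.coef, Matrix.smul_mul, hE3, Matrix.mul_smul, hE2]
  push_cast
  module

theorem isFundamentalMatrix_gaugedFund (h : IsPeriodicHermitian Q) (lam : ℂ) :
    IsFundamentalMatrix Q lam (h.gaugedFund lam) where
  absolutelyContinuous i j a b :=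
    ((h.gaugedFund_isIntegralOf lam).entry i j).absolutelyContinuousOnInterval a b
  equation := by
    have hd : ∀ᵐ x : ℝ, ∀ i j, HasDerivAt (fun t => h.gaugedFund lam t i j)
        ((J * (Q x - lam • (1 : M2)) * h.gaugedFund lam x) i j) x := by
      simp only [ae_all_iff]
      exact fun i j => ((h.gaugedFund_isIntegralOf lam).entry i j).ae_hasDerivAt
    filter_upwards [hd] with x hx
    refine ⟨_, hx, ?_⟩
    rw [← mul_assoc, ← mul_assoc, J_mul_J, neg_one_mul, neg_sub, sub_mul, sub_add_cancel,
      smul_one_mul]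
  initial := h.gaugedFund_zero lam

theorem isIntegralOf_of_isFundamentalMatrix (h : IsPeriodicHermitian Q) {lam : ℂ} {Y : ℝ → M2}
    (hY : IsFundamentalMatrix Q lam Y) :
    IsIntegralOf Y fun x => J * (Q x - lam • (1 : M2)) * Y x := by
  refine isIntegralOf_matrix fun i j => .of_absolutelyContinuous
    (hY.absolutelyContinuous i j) ?_ fun a b => ?_
  · filter_upwards [hY.equation] with x ⟨Y', hd, he⟩
    have : Y' = J * (Q x - lam • (1 : M2)) * Y x := by
      rw [mul_assoc, sub_mul, smul_one_mul, ← he, sub_add_cancel_right, mul_neg, ← mul_assoc,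
        J_mul_J, neg_one_mul, neg_neg]
    rw [← this]
    exact hd i j
  · simp only [Matrix.mul_apply (M := J * _), Fin.sum_univ_two]
    have hc (k : Fin 2) : IntervalIntegrable
        (fun x => (J * (Q x - lam • (1 : M2))) i k * Y x k j) volume a b :=
      IntervalIntegrable.mul_continuousOn
        (intervalIntegrable_entry (h.coef_intervalIntegrable lam a b) i k)
        (hY.absolutelyContinuous k j a b).continuousOn
    exact (hc 0).add (hc 1)

/-- The gauged solution shows that the choice in `fundamentalMatrix` is not vacuous, and one-sided
uniqueness identifies it. Only `x = π` is needed for the discriminant. -/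
theorem fundamentalMatrix_eq (h : IsPeriodicHermitian Q) (lam : ℂ) {x : ℝ} (hx : 0 ≤ x) :
    fundamentalMatrix Q lam x = h.gaugedFund lam x := by
  have hY : IsFundamentalMatrix Q lam (fundamentalMatrix Q lam) :=
    Classical.epsilon_spec ⟨_, h.isFundamentalMatrix_gaugedFund lam⟩
  exact (h.isIntegralOf_of_isFundamentalMatrix hY).eq_of_mul (h.coef_intervalIntegrable lam)
    (h.gaugedFund_isIntegralOf lam) (hY.initial.trans (h.gaugedFund_zero lam).symm) hx

theorem discriminant_eq (h : IsPeriodicHermitian Q) (lam : ℂ) : discriminant Q lam =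
    Complex.exp (-Complex.I * (∫ t in (0 : ℝ)..Real.pi, (Q t 0 1).im : ℝ))
      * h.potential.disc (lam - scalarMean Q) := by
  rw [discriminant, h.fundamentalMatrix_eq lam Real.pi_pos.le, gaugedFund, h.angle_pi,
    DiracPotential.disc]
  simp

/-- The two functions differ by a nonzero constant factor and a real translation of the variable,
neither of which affects orders of zeros. -/
theorem onlyDoubleZeros_iff (h : IsPeriodicHermitian Q) :
    (OnlyDoubleZeros fun lam => discriminant Q lam
      - 2 * Complex.exp (-Complex.I * (∫ t in (0 : ℝ)..Real.pi, (Q t 0 1).im : ℝ))) ↔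
    OnlyDoubleZeros fun lam => h.potential.disc lam - 2 := by
  set c := Complex.exp (-Complex.I * (∫ t in (0 : ℝ)..Real.pi, (Q t 0 1).im : ℝ)) with hc
  have hc0 : c ≠ 0 := Complex.exp_ne_zero _
  have e : (fun lam => discriminant Q lam - 2 * c)
      = (fun _ => c) * ((fun lam => h.potential.disc lam - 2) ∘ fun lam => lam - scalarMean Q) := by
    funext lam
    simp only [h.discriminant_eq, ← hc, Pi.mul_apply, Function.comp_apply]
    ring
  have hG : Differentiable ℂ fun lam => h.potential.disc lam - 2 :=
    h.potential.differentiable_disc.sub_const 2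
  have hs : Differentiable ℂ fun lam : ℂ => lam - scalarMean Q := by fun_prop
  have hord (lam : ℂ) : analyticOrderAt (fun lam => discriminant Q lam - 2 * c) lam
      = analyticOrderAt (fun lam => h.potential.disc lam - 2) (lam - scalarMean Q) := by
    rw [e, analyticOrderAt_mul analyticAt_const ((hG.comp hs).analyticAt lam),
      analyticAt_const.analyticOrderAt_eq_zero.2 hc0, zero_add,
      analyticOrderAt_comp_of_deriv_ne_zero (hs.analyticAt lam) (by simp)]
  have hz (lam : ℂ) : discriminant Q lam - 2 * c = 0
      ↔ h.potential.disc (lam - scalarMean Q) - 2 = 0 := by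
    rw [congrFun e lam]
    simp [hc0]
  refine ⟨fun H lam h0 => ?_, fun H lam h0 => ?_⟩
  · have := H (lam + scalarMean Q) ((hz _).2 (by simpa using h0))
    rwa [hord, add_sub_cancel_right] at this
  · rw [hord]
    exact H _ ((hz lam).1 h0)

/-- The increment over a half period is a constant `θ(π/2)`, and twice this constant is `θ(π) = 0`.
-/
theorem angle_add_half (h : IsPeriodicHermitian Q)
    (hs : ∀ᵐ x : ℝ, scalarPart Q (x + Real.pi / 2) = scalarPart Q x) (x : ℝ) :
    angle Q (x + Real.pi / 2) = angle Q x := by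
  have hi := (h.angle_isIntegralOf.comp_add_right (Real.pi / 2)).congr_ae
    (g := fun x => scalarPart Q x - scalarMean Q) (by filter_upwards [hs] with x hx; rw [hx])
  have h0 : angle Q 0 = 0 := by simp [angle]
  have hx (x : ℝ) : angle Q (x + Real.pi / 2) = angle Q (Real.pi / 2) + angle Q x := by
    rw [hi.eq_add x, h.angle_isIntegralOf.eq_add x, h0]
    simp
  have h1 := hx (Real.pi / 2)
  rw [add_halves, h.angle_pi] at h1
  linarith [hx x]

theorem potential_antiperiodic (h : IsPeriodicHermitian Q)
    (h1 : ∀ᵐ x : ℝ, Q1 Q (x + Real.pi / 2) = -Q1 Q x)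
    (h2 : ∀ᵐ x : ℝ, Q2 Q (x + Real.pi / 2) = Q2 Q x) :
    ∀ᵐ x : ℝ, h.potential.mat (x + Real.pi / 2) = -h.potential.mat x := by
  have hs : ∀ᵐ x : ℝ, scalarPart Q (x + Real.pi / 2) = scalarPart Q x := by
    filter_upwards [h2] with x hx
    have := congrFun (congrFun hx 0) 0
    rw [h.Q2_eq, h.Q2_eq] at this
    simpa using this
  have hmat (x : ℝ) : h.potential.mat x = rot (-angle Q x) * (Q1 Q x * rot (angle Q x)) := by
    rw [← h.rot_mul_potential, ← mul_assoc, rot_neg_mul, one_mul]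
  filter_upwards [h1] with x hx
  rw [hmat, hmat, h.angle_add_half hs, hx, neg_mul, mul_neg]

end IsPeriodicHermitian

end SelfAdjointSystem

theorem theorem5p2 (Q : ℝ → Matrix (Fin 2) (Fin 2) ℂ)
    (hHerm : ∀ x, (Q x).IsHermitian)
    (hper : Function.Periodic Q Real.pi)
    (hint : ∀ i j : Fin 2, IntegrableOn (fun x => Q x i j) (Set.Ico 0 Real.pi) volume) :
    ((∀ᵐ x : ℝ, SelfAdjointSystem.Q1 Q (x + Real.pi / 2) = -SelfAdjointSystem.Q1 Q x) →
      (∀ᵐ x : ℝ, SelfAdjointSystem.Q2 Q (x + Real.pi / 2) = SelfAdjointSystem.Q2 Q x) →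
      SelfAdjointSystem.OnlyDoubleZeros (fun lam => SelfAdjointSystem.discriminant Q lam -
        2 * Complex.exp (-Complex.I * ((∫ t in (0 : ℝ)..Real.pi, (Q t 0 1).im : ℝ) : ℂ)))) ∧
    (SelfAdjointSystem.OnlyDoubleZeros (fun lam => SelfAdjointSystem.discriminant Q lam -
        2 * Complex.exp (-Complex.I * ((∫ t in (0 : ℝ)..Real.pi, (Q t 0 1).im : ℝ) : ℂ))) →
      (∀ᵐ x : ℝ,
        SelfAdjointSystem.Q1tilde Q (x + Real.pi / 2) = -SelfAdjointSystem.Q1tilde Q x) ∧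
      (∀ᵐ x : ℝ,
        SelfAdjointSystem.Q2tilde Q (x + Real.pi / 2) = SelfAdjointSystem.Q2tilde Q x)) := by
  have h : SelfAdjointSystem.IsPeriodicHermitian Q := ⟨hHerm, hper, hint⟩
  refine ⟨fun h1 h2 => h.onlyDoubleZeros_iff.2
    (h.potential.onlyDoubleZeros_of_antiperiodic (h.potential_antiperiodic h1 h2)),
    fun hd => ⟨?_, Eventually.of_forall fun x => rfl⟩⟩
  simp only [h.Q1tilde_eq]
  exact h.potential.antiperiodic_of_onlyDoubleZeros h.shift_potential (h.onlyDoubleZeros_iff.1 hd)
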